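/- Let $(M,g)$ be a connected smooth Riemannian manifold of dimension $n$, let $f\in C^\infty(M)$ with $f>0$, and let $p,q\ge 0$. Let $\pi:T^p_q(M)\to M$ be the bundle of $(p,q)$-tensors. Write $\nabla$ for the Levi-Civita connection of $g$, $\Gamma^k_{ij}$ for its coefficients, $R(X,Y)=[\nabla_X,\nabla_Y]-\nabla_{[X,Y]}$ for its curvature, and $R(\partial_l,\partial_j)\partial_k=R_{ljk}{}^{s}\,\partial_s$. In the coordinates $(x^j,t^{i_1\dots i_p}_{j_1\dots j_q})$ induced on $T^p_q(M)$ by a chart of $M$, the vertical lift ${}^VA$ of a $(p,q)$-tensor $A$ has components $(0,A^{i_1\dots i_p}_{j_1\dots j_q})$, and the horizontal lift ${}^HX$ of a vector $X$ has components $$\Bigl(X^j,\;X^s\Bigl(\sum_{\mu=1}^q\Gamma^m_{sj_\mu}t^{i_1\dots i_p}_{j_1\dots m\dots j_q}-\sum_{\lambda=1}^p\Gamma^{i_\lambda}_{sm}t^{i_1\dots m\dots i_p}_{j_1\dots j_q}\Bigr)\Bigr).$$ The rescaled Sasaki type metric ${}^Sg_f$ on $T^p_q(M)$ is given by $${}^Sg_f({}^HX,{}^HY)=f\,g(X,Y),\qquad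 {}^Sg_f({}^VA,{}^HY)=0,\qquad {}^Sg_f({}^VA,{}^VB)=g_{i_1k_1}\cdots g_{i_pk_p}\,g^{j_1l_1}\cdots g^{j_ql_q}A^{i_1\dots i_p}_{j_1\dots j_q}B^{k_1\dots k_p}_{l_1\dots l_q}.$$ Let ${}^{(M)}\widehat\nabla$ be the metric connection of ${}^Sg_f$ whose torsion tensor at a point $t\in T^p_q(M)$ vanishes as soon as one argument is vertical and satisfies $$T({}^H\partial_l,{}^H\partial_j)={}^V\Bigl(\sum_{\lambda=1}^pR_{ljm}{}^{i_\lambda}\,t^{i_1\dots m\dots i_p}_{j_1\dots j_q}-\sum_{\mu=1}^qR_{ljj_\mu}{}^{m}\,t^{i_1\dots i_p}_{j_1\dots m\dots j_q}\Bigr).$$ A geodesic of a connection is a $C^2$ curve $c$, defined on an open interval, whose velocity is parallel along $c$. Then: 1. For every geodesic $\widetilde\gamma$ of ${}^{(M)}\widehat\nabla$ in $T^p_q(M)$, with projection $\gamma=\pi\circ\widetilde\gamma$, the tensor field $t^{v_1\dots v_p}_{r_1\dots r_q}(s)$ along $\gamma$ defined by $\widetilde\gamma$ has vanishing second covariant derivative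 (with respect to $\nabla$) along $\gamma$: $\dfrac{\delta^2t^{v_1\dots v_p}_{r_1\dots r_q}}{ds^2}=0$. 2. The projection $\gamma=\pi\circ\widetilde\gamma$ of every geodesic $\widetilde\gamma$ of ${}^{(M)}\widehat\nabla$ is a geodesic of the Levi-Civita connection $\nabla$ of $(M,g)$ if and only if $f$ is constant. 3. The equivalence in 2 also holds when "every geodesic $\widetilde\gamma$" is restricted to the geodesics $\widetilde\gamma$ that are parametrized by arc length with respect to ${}^Sg_f$. -/

import Mathlib

open scoped Manifold ContDiff

noncomputable section

namespace RescaledSasaki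

/-! ### Metrics and Christoffel symbols in a coordinate domain -/

section Coordinates

variable {κ : Type*} [Fintype κ] [DecidableEq κ]

/-- The partial derivative `∂_a F` at `z` of a function of the coordinates indexed by `κ`. -/
def pd (a : κ) (F : (κ → ℝ) → ℝ) (z : κ → ℝ) : ℝ :=
  fderiv ℝ F z (Pi.single a 1)

/-- The Christoffel symbol `Γ^c_{ab}` at `z` of the Levi-Civita connection of the metric whose
matrix of components in the coordinates is `G`:
`Γ^c_{ab} = (1/2) G^{cd} (∂_a G_{bd} + ∂_b G_{ad} - ∂_d G_{ab})`. -/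
def christoffel (G : (κ → ℝ) → Matrix κ κ ℝ) (z : κ → ℝ) (c a b : κ) : ℝ :=
  (1 / 2) * ∑ d, (G z)⁻¹ c d *
    (pd a (fun w => G w b d) z + pd b (fun w => G w a d) z - pd d (fun w => G w a b) z)

/-- The component `R_{ljk}^s` of the curvature tensor `R(X,Y) = [∇_X,∇_Y] - ∇_{[X,Y]}` of the
connection with Christoffel symbols `Γ z s j k = Γ^s_{jk}(z)`, that is
`R(∂_l,∂_j)∂_k = R_{ljk}^s ∂_s`. -/
def curvature (Γ : (κ → ℝ) → κ → κ → κ → ℝ) (z : κ → ℝ) (l j k s : κ) : ℝ :=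
  pd l (fun w => Γ w s j k) z - pd j (fun w => Γ w s l k) z
    + ∑ m, (Γ z s l m * Γ z m j k - Γ z s j m * Γ z m l k)

/-- The contorsion `U^c_{ab}` of the torsion `T^c_{ab} = T z c a b` with respect to the metric `G`:
lowering the upper index to the last place,
`U_{abc} = (1/2) (T_{abc} + T_{cab} + T_{cba})`. -/
def contorsion (G : (κ → ℝ) → Matrix κ κ ℝ) (T : (κ → ℝ) → κ → κ → κ → ℝ)
    (z : κ → ℝ) (c a b : κ) : ℝ :=
  let low : κ → κ → κ → ℝ := fun a b d => ∑ e, T z e a b * G z e d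
  ∑ d, (1 / 2) * (low a b d + low d a b + low d b a) * (G z)⁻¹ d c

/-- The connection coefficients `Γ^c_{ab}`, with `∇_{∂_a} ∂_b = Γ^c_{ab} ∂_c`, of the metric
connection of `G` with torsion `T` (Levi-Civita connection plus contorsion). -/
def metricConnection (G : (κ → ℝ) → Matrix κ κ ℝ) (T : (κ → ℝ) → κ → κ → κ → ℝ)
    (z : κ → ℝ) (c a b : κ) : ℝ :=
  christoffel G z c a b + contorsion G T z c a b

/-- Coordinate form of `∇_{c'} c' = 0` at the parameter `t`, for a curve `X` in the coordinate
domain and a connection with coefficients `Γ z c a b = Γ^c_{ab}(z)`. -/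
def GeodesicEquation (Γ : (κ → ℝ) → κ → κ → κ → ℝ) (X : ℝ → κ → ℝ) (t : ℝ) : Prop :=
  ∀ c, deriv (fun r => deriv (fun s => X s c) r) t
    + ∑ a, ∑ b, Γ (X t) c a b * deriv (fun s => X s a) t * deriv (fun s => X s b) t = 0

end Coordinates

section Facts

variable {κ : Type*} [Fintype κ] [DecidableEq κ]

theorem sum_christoffel_mul (G : (κ → ℝ) → Matrix κ κ ℝ) (hG : ∀ w, (G w).IsSymm)
    (z : κ → ℝ) (hz : IsUnit (G z).det) (a b d : κ) :
    ∑ c, christoffel G z c a b * G z c d = (1 / 2) *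
      (pd a (fun w => G w b d) z + pd b (fun w => G w a d) z - pd d (fun w => G w a b) z) := by
  have h1 : ∀ r, ∑ c, (G z)⁻¹ c r * G z c d = if r = d then 1 else 0 := by
    intro r
    have := congrFun (congrFun (Matrix.mul_nonsing_inv (G z) hz) d) r
    rw [Matrix.mul_apply, Matrix.one_apply] at this
    rw [show (if r = d then (1 : ℝ) else 0) = if d = r then 1 else 0 by simp [eq_comm], ← this]
    refine Finset.sum_congr rfl fun c _ => ?_
    rw [mul_comm, (hG z).apply]
  simp only [christoffel, Finset.mul_sum, Finset.sum_mul]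
  rw [Finset.sum_comm]
  have h2 : ∀ r, ∑ c, 1 / 2 * ((G z)⁻¹ c r * (pd a (fun w => G w b r) z
      + pd b (fun w => G w a r) z - pd r (fun w => G w a b) z)) * G z c d
      = (∑ c, (G z)⁻¹ c r * G z c d) * (1 / 2 * (pd a (fun w => G w b r) z
      + pd b (fun w => G w a r) z - pd r (fun w => G w a b) z)) := by
    intro r
    rw [Finset.sum_mul]
    exact Finset.sum_congr rfl fun c _ => by ring
  simp only [mul_assoc] at h2 ⊢
  simp only [h2, h1]
  simp

theorem sum_contorsion_mul (G : (κ → ℝ) → Matrix κ κ ℝ) (T : (κ → ℝ) → κ → κ → κ → ℝ)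
    (z : κ → ℝ) (hz : IsUnit (G z).det) (a b d : κ) :
    ∑ c, contorsion G T z c a b * G z c d = (1 / 2) *
      (∑ e, T z e a b * G z e d + ∑ e, T z e d a * G z e b + ∑ e, T z e d b * G z e a) := by
  have h1 : ∀ r, ∑ c, (G z)⁻¹ r c * G z c d = if r = d then 1 else 0 := by
    intro r
    have := congrFun (congrFun (Matrix.nonsing_inv_mul (G z) hz) r) d
    rwa [Matrix.mul_apply, Matrix.one_apply] at this
  simp only [contorsion, Finset.sum_mul]
  rw [Finset.sum_comm]
  simp only [mul_assoc, ← Finset.mul_sum, h1]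
  simp

/-- `metricConnection G T` is a metric connection: `∇G = 0`. -/
theorem metricConnection_metric (G : (κ → ℝ) → Matrix κ κ ℝ) (hG : ∀ w, (G w).IsSymm)
    (T : (κ → ℝ) → κ → κ → κ → ℝ) (hT : ∀ w c a b, T w c a b = - T w c b a)
    (z : κ → ℝ) (hz : IsUnit (G z).det) (a b d : κ) :
    pd a (fun w => G w b d) z - ∑ c, metricConnection G T z c a b * G z c d
      - ∑ c, metricConnection G T z c a d * G z b c = 0 := by
  have hs : ∀ r s, (fun w => G w r s) = fun w => G w s r := fun r s =>
    funext fun w => (hG w).apply s r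
  simp only [metricConnection, add_mul, Finset.sum_add_distrib, ← (hG z).apply b,
    sum_christoffel_mul G hG z hz, sum_contorsion_mul G T z hz]
  have e : ∀ r s u, ∑ e, T z e r s * G z e u = - ∑ e, T z e s r * G z e u := fun r s u => by
    rw [← Finset.sum_neg_distrib]
    exact Finset.sum_congr rfl fun k _ => by rw [hT z k r s]; ring
  rw [hs d b, e d b a, e d a b, e b a d]
  ring

/-- The torsion of `metricConnection G T` is `T`. -/
theorem metricConnection_torsion (G : (κ → ℝ) → Matrix κ κ ℝ) (hG : ∀ w, (G w).IsSymm)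
    (T : (κ → ℝ) → κ → κ → κ → ℝ) (hT : ∀ w c a b, T w c a b = - T w c b a)
    (z : κ → ℝ) (hz : IsUnit (G z).det) (c a b : κ) :
    metricConnection G T z c a b - metricConnection G T z c b a = T z c a b := by
  have hs : ∀ r s, (fun w => G w r s) = fun w => G w s r := fun r s =>
    funext fun w => (hG w).apply s r
  have e : ∀ r s u, ∑ e, T z e r s * G z e u = - ∑ e, T z e s r * G z e u := fun r s u => by
    rw [← Finset.sum_neg_distrib]
    exact Finset.sum_congr rfl fun k _ => by rw [hT z k r s]; ring
  have key : Matrix.vecMul (fun c => metricConnection G T z c a b - metricConnection G T z c b a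
      - T z c a b) (G z) = 0 := by
    funext d
    simp only [Matrix.vecMul, dotProduct, sub_mul, Finset.sum_sub_distrib, metricConnection,
      add_mul, Finset.sum_add_distrib, sum_christoffel_mul G hG z hz,
      sum_contorsion_mul G T z hz, Pi.zero_apply]
    rw [hs b a, e b a d]
    ring
  have h := congrArg (fun v => Matrix.vecMul v (G z)⁻¹) key
  simp only [Matrix.vecMul_vecMul, Matrix.mul_nonsing_inv _ hz, Matrix.vecMul_one,
    Matrix.zero_vecMul] at h
  have := congrFun h c
  simp only [Pi.zero_apply] at this
  linarith

end Facts

/-! ### The base manifold -/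

/-- A Riemannian metric of class `C^∞` on an `n`-dimensional manifold `M`. -/
abbrev Metric (n : ℕ) (M : Type*) [TopologicalSpace M] [ChartedSpace (EuclideanSpace ℝ (Fin n)) M]
    [IsManifold (𝓡 n) ∞ M] :=
  Bundle.ContMDiffRiemannianMetric (𝓡 n) ∞ (EuclideanSpace ℝ (Fin n))
    (fun x : M => TangentSpace (𝓡 n) x)

/-- Tensors of type `(p,q)` over a real vector space: multilinear in `p` covectors and in `q`
vectors. -/
abbrev Tensor (p q : ℕ) (V : Type*) [AddCommGroup V] [Module ℝ V] :=
  MultilinearMap ℝ (fun _ : Fin p => Module.Dual ℝ V)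
    (MultilinearMap ℝ (fun _ : Fin q => V) ℝ)

/-- Families of components `A^{i_1 … i_p}_{j_1 … j_q}`, written `A i j`. -/
abbrev Components (n p q : ℕ) := (Fin p → Fin n) → (Fin q → Fin n) → ℝ

/-- Index set of the `n + n^{p+q}` coordinates `(x^j, t^{i_1 … i_p}_{j_1 … j_q})` of the tensor
bundle. -/
abbrev Idx (n p q : ℕ) := Fin n ⊕ ((Fin p → Fin n) × (Fin q → Fin n))

section Manifold

variable {n : ℕ} {M : Type*} [TopologicalSpace M] [ChartedSpace (EuclideanSpace ℝ (Fin n)) M]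

/-- The tensor bundle `T^p_q(M)`, the disjoint union of the tensor spaces `T^p_q(x)`, `x ∈ M`; the
projection onto `M` is the first component. -/
def TensorBundle (n : ℕ) (M : Type*) [TopologicalSpace M]
    [ChartedSpace (EuclideanSpace ℝ (Fin n)) M] (p q : ℕ) :=
  Σ x : M, Tensor p q (TangentSpace (𝓡 n) x)

/-- The natural projection `T^p_q(M) → M`. -/
def proj {p q : ℕ} (P : TensorBundle n M p q) : M := P.1

/-- The coordinate vector `∂_i` of the chart `e` at the point `y` of its domain. -/
def frame (e : OpenPartialHomeomorph M (EuclideanSpace ℝ (Fin n))) (y : M) (i : Fin n) :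
    TangentSpace (𝓡 n) y :=
  mfderiv (𝓡 n) (𝓡 n) e.symm (e y) (EuclideanSpace.single i (1 : ℝ))

/-- The coordinate covector `dx^i` of the chart `e` at the point `y` of its domain. -/
def coframe (e : OpenPartialHomeomorph M (EuclideanSpace ℝ (Fin n))) (y : M) (i : Fin n) :
    Module.Dual ℝ (TangentSpace (𝓡 n) y) :=
  ((EuclideanSpace.proj i : EuclideanSpace ℝ (Fin n) →L[ℝ] ℝ).comp
    (mfderiv (𝓡 n) (𝓡 n) e y : TangentSpace (𝓡 n) y →L[ℝ] EuclideanSpace ℝ (Fin n))).toLinearMap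

/-- The coordinates `x^i` of a point of `M` in the chart `e`. -/
def coord (e : OpenPartialHomeomorph M (EuclideanSpace ℝ (Fin n))) (y : M) : Fin n → ℝ :=
  fun i => e y i

/-- The point of `M` with coordinates `x` in the chart `e`. -/
def point (e : OpenPartialHomeomorph M (EuclideanSpace ℝ (Fin n))) (x : Fin n → ℝ) : M :=
  e.symm (WithLp.toLp 2 x)

/-- The components of the tensor `P.2` at `P.1` in the natural base of the chart `e`. -/
def components {p q : ℕ} (e : OpenPartialHomeomorph M (EuclideanSpace ℝ (Fin n)))
    (P : TensorBundle n M p q) : Components n p q :=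
  fun i j => P.2 (fun a => coframe e P.1 (i a)) (fun b => frame e P.1 (j b))

/-- The coordinates `(x^j, t^{i_1 … i_p}_{j_1 … j_q})` on the tensor bundle induced by the
chart `e`. -/
def bundleCoord {p q : ℕ} (e : OpenPartialHomeomorph M (EuclideanSpace ℝ (Fin n)))
    (P : TensorBundle n M p q) : Idx n p q → ℝ :=
  Sum.elim (coord e P.1) (fun ij => components e P ij.1 ij.2)

/-- Base part `x` of a point `(x,t)`, or of a tangent vector, in induced coordinates. -/
def basePart {p q : ℕ} (z : Idx n p q → ℝ) : Fin n → ℝ := fun i => z (Sum.inl i)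

/-- Fibre part `t` of a point `(x,t)`, or of a tangent vector, in induced coordinates. -/
def fibrePart {p q : ℕ} (z : Idx n p q → ℝ) : Components n p q := fun i j => z (Sum.inr (i, j))

/-- The pair `(x,t)` in induced coordinates. -/
def mkIdx {p q : ℕ} (x : Fin n → ℝ) (A : Components n p q) : Idx n p q → ℝ :=
  Sum.elim x (fun ij => A ij.1 ij.2)

/-- `∑_λ φ_m^{i_λ} A^{i_1 … m … i_p}_{j_1 … j_q} - ∑_μ φ_{j_μ}^m A^{i_1 … i_p}_{j_1 … m … j_q}`,
the action on `(p,q)`-components of an endomorphism with components `φ k m = φ_m^k`. -/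
def act {p q : ℕ} (φ : Fin n → Fin n → ℝ) (A : Components n p q) : Components n p q :=
  fun i j => ∑ a, ∑ m, φ (i a) m * A (Function.update i a m) j
    - ∑ b, ∑ m, φ m (j b) * A i (Function.update j b m)

variable [IsManifold (𝓡 n) ∞ M]

/-- The components `g_{ij}` of the metric in the chart `e`. -/
def metricMatrix (g : Metric n M) (e : OpenPartialHomeomorph M (EuclideanSpace ℝ (Fin n)))
    (x : Fin n → ℝ) : Matrix (Fin n) (Fin n) ℝ :=
  fun i j => g.inner (point e x) (frame e (point e x) i) (frame e (point e x) j)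

/-- The Christoffel symbols `Γ^k_{ij}` of the Levi-Civita connection `∇` of `g` in the chart `e`. -/
def baseChristoffel (g : Metric n M) (e : OpenPartialHomeomorph M (EuclideanSpace ℝ (Fin n))) :
    (Fin n → ℝ) → Fin n → Fin n → Fin n → ℝ :=
  christoffel (metricMatrix g e)

/-- The term `∑_λ Γ^{i_λ}_{lm} ξ^l A^{… m …}_{…} - ∑_μ Γ^m_{l j_μ} ξ^l A^{…}_{… m …}` of the
covariant derivative of a `(p,q)`-tensor field in the direction `ξ` at the point `x`. -/
def connectionTerm (g : Metric n M) (e : OpenPartialHomeomorph M (EuclideanSpace ℝ (Fin n)))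
    {p q : ℕ} (x ξ : Fin n → ℝ) (A : Components n p q) : Components n p q :=
  act (fun k m => ∑ l, ξ l * baseChristoffel g e x k l m) A

/-- The covariant derivative `δA/dt`, along the curve `γ` in `M`, of a `(p,q)`-tensor field along
`γ`, given by its components `A t` in the chart `e`. -/
def covDeriv (g : Metric n M) (e : OpenPartialHomeomorph M (EuclideanSpace ℝ (Fin n)))
    {p q : ℕ} (γ : ℝ → M) (A : ℝ → Components n p q) (t : ℝ) : Components n p q :=
  fun i j => deriv (fun s => A s i j) t
    + connectionTerm g e (coord e (γ t)) (fun l => deriv (fun s => coord e (γ s) l) t) (A t) i j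

/-! ### The rescaled Sasaki type metric on the tensor bundle -/

/-- The vertical lift of a tensor with components `A`. -/
def verticalLift {p q : ℕ} (A : Components n p q) : Idx n p q → ℝ := mkIdx 0 A

/-- The horizontal lift of `ξ = ξ^i ∂_i` to the point `z = (x,t)`. -/
def horizontalLift (g : Metric n M) (e : OpenPartialHomeomorph M (EuclideanSpace ℝ (Fin n)))
    {p q : ℕ} (z : Idx n p q → ℝ) (ξ : Fin n → ℝ) : Idx n p q → ℝ :=
  mkIdx ξ (- connectionTerm g e (basePart z) ξ (fibrePart z))

/-- The tensor `A` such that `v` is the sum of the horizontal lift of its base part and of the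
vertical lift of `A`, for a tangent vector `v` at `z`. -/
def verticalPart (g : Metric n M) (e : OpenPartialHomeomorph M (EuclideanSpace ℝ (Fin n)))
    {p q : ℕ} (z v : Idx n p q → ℝ) : Components n p q :=
  fibrePart v + connectionTerm g e (basePart z) (basePart v) (fibrePart z)

/-- The extension of the scalar product to tensors,
`G(A,B) = g_{i_1 k_1} ⋯ g_{i_p k_p} g^{j_1 l_1} ⋯ g^{j_q l_q} A^{i…}_{j…} B^{k…}_{l…}`. -/
def tensorInner (g : Metric n M) (e : OpenPartialHomeomorph M (EuclideanSpace ℝ (Fin n)))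
    {p q : ℕ} (x : Fin n → ℝ) (A B : Components n p q) : ℝ :=
  ∑ i, ∑ k, ∑ j, ∑ l, (∏ a, metricMatrix g e x (i a) (k a)) *
    (∏ b, (metricMatrix g e x)⁻¹ (j b) (l b)) * A i j * B k l

/-- The rescaled Sasaki type metric of `T^p_q(M)`, evaluated on tangent vectors `v`, `w` at `z`, in
the coordinates induced by `e`: on horizontal lifts it is `f g`, on vertical lifts it is `G`, and
horizontal and vertical lifts are orthogonal. -/
def sasaki (g : Metric n M) (f : M → ℝ) (e : OpenPartialHomeomorph M (EuclideanSpace ℝ (Fin n)))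
    {p q : ℕ} (z v w : Idx n p q → ℝ) : ℝ :=
  f (point e (basePart z)) *
      (∑ i, ∑ j, metricMatrix g e (basePart z) i j * basePart v i * basePart w j)
    + tensorInner g e (basePart z) (verticalPart g e z v) (verticalPart g e z w)

section SasakiFacts

variable (g : Metric n M) (f : M → ℝ) (e : OpenPartialHomeomorph M (EuclideanSpace ℝ (Fin n)))
  {p q : ℕ} (z : Idx n p q → ℝ)

theorem basePart_mkIdx (x : Fin n → ℝ) (A : Components n p q) : basePart (mkIdx x A) = x := rfl

theorem fibrePart_mkIdx (x : Fin n → ℝ) (A : Components n p q) : fibrePart (mkIdx x A) = A := rfl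

theorem verticalPart_verticalLift (A : Components n p q) :
    verticalPart g e z (verticalLift A) = A := by
  funext i j
  simp [verticalPart, verticalLift, fibrePart_mkIdx, basePart_mkIdx, connectionTerm, act]

theorem verticalPart_horizontalLift (ξ : Fin n → ℝ) :
    verticalPart g e z (horizontalLift g e z ξ) = 0 := by
  rw [verticalPart, horizontalLift, fibrePart_mkIdx, basePart_mkIdx, neg_add_cancel]

theorem sasaki_vertical_vertical (A B : Components n p q) :
    sasaki g f e z (verticalLift A) (verticalLift B) = tensorInner g e (basePart z) A B := by
  rw [sasaki, verticalPart_verticalLift, verticalPart_verticalLift]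
  simp [verticalLift, basePart_mkIdx]

theorem sasaki_vertical_horizontal (A : Components n p q) (ξ : Fin n → ℝ) :
    sasaki g f e z (verticalLift A) (horizontalLift g e z ξ) = 0 := by
  rw [sasaki, verticalPart_verticalLift, verticalPart_horizontalLift]
  simp [verticalLift, basePart_mkIdx, tensorInner]

theorem sasaki_horizontal_horizontal (ξ η : Fin n → ℝ) :
    sasaki g f e z (horizontalLift g e z ξ) (horizontalLift g e z η) =
      f (point e (basePart z)) * ∑ i, ∑ j, metricMatrix g e (basePart z) i j * ξ i * η j := by
  rw [sasaki, verticalPart_horizontalLift, verticalPart_horizontalLift]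
  simp [horizontalLift, basePart_mkIdx, tensorInner]

end SasakiFacts

/-- The matrix of components of the rescaled Sasaki type metric in induced coordinates. -/
def sasakiMatrix (g : Metric n M) (f : M → ℝ)
    (e : OpenPartialHomeomorph M (EuclideanSpace ℝ (Fin n))) {p q : ℕ} (z : Idx n p q → ℝ) :
    Matrix (Idx n p q) (Idx n p q) ℝ :=
  fun a b => sasaki g f e z (Pi.single a 1) (Pi.single b 1)

/-- The torsion tensor prescribed for the metric connection. At `(x,t)` its only non-zero
components `T^c_{ab}` have `a = l`, `b = j` in the base and `c` in the fibre, with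
`T_{lj} = ∑_λ R_{ljm}^{i_λ} t^{i_1 … m … i_p}_{j_1 … j_q}
  - ∑_μ R_{lj j_μ}^m t^{i_1 … i_p}_{j_1 … m … j_q}`.
As `T` is vertical-valued and vanishes on vertical vectors, these are its components both in the
natural frame `(∂_j, ∂_{\bar j})` and in the adapted frame `(E_j, E_{\bar j})`, where `E_j` is the
horizontal lift of `∂_j` and `E_{\bar j} = ∂_{\bar j}`. -/
def torsion (g : Metric n M) (e : OpenPartialHomeomorph M (EuclideanSpace ℝ (Fin n)))
    {p q : ℕ} (z : Idx n p q → ℝ) : Idx n p q → Idx n p q → Idx n p q → ℝ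
  | Sum.inr (i, j), Sum.inl l, Sum.inl r =>
      act (fun k m => curvature (baseChristoffel g e) (basePart z) l r m k) (fibrePart z) i j
  | _, _, _ => 0

/-- The coefficients, in the natural frame of the coordinates induced by `e`, of the metric
connection of the rescaled Sasaki type metric with the torsion above. -/
def bundleConnection (g : Metric n M) (f : M → ℝ)
    (e : OpenPartialHomeomorph M (EuclideanSpace ℝ (Fin n))) (p q : ℕ) :
    (Idx n p q → ℝ) → Idx n p q → Idx n p q → Idx n p q → ℝ :=
  metricConnection (sasakiMatrix g f e) (torsion g e)

/-! ### Geodesics -/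

/-- `γ`, restricted to the open interval `J`, is a `C²` curve in `M` and a geodesic of the
Levi-Civita connection of `g`: the geodesic equation holds in every smooth chart. -/
def IsGeodesic (g : Metric n M) (J : Set ℝ) (γ : ℝ → M) : Prop :=
  IsOpen J ∧ J.OrdConnected ∧ ContinuousOn γ J ∧
  ∀ e ∈ IsManifold.maximalAtlas (𝓡 n) ∞ M, ∀ t ∈ J, γ t ∈ e.source →
    ContDiffAt ℝ 2 (fun s => coord e (γ s)) t ∧
    GeodesicEquation (baseChristoffel g e) (fun s => coord e (γ s)) t

/-- `c`, restricted to the open interval `J`, is a `C²` curve in `T^p_q(M)` and a geodesic of the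
metric connection above of the rescaled Sasaki type metric: the geodesic equation holds in the
coordinates induced by every smooth chart of `M`. -/
def IsBundleGeodesic (g : Metric n M) (f : M → ℝ) {p q : ℕ} (J : Set ℝ)
    (c : ℝ → TensorBundle n M p q) : Prop :=
  IsOpen J ∧ J.OrdConnected ∧ ContinuousOn (fun s => proj (c s)) J ∧
  ∀ e ∈ IsManifold.maximalAtlas (𝓡 n) ∞ M, ∀ t ∈ J, proj (c t) ∈ e.source →
    ContDiffAt ℝ 2 (fun s => bundleCoord e (c s)) t ∧
    GeodesicEquation (bundleConnection g f e p q) (fun s => bundleCoord e (c s)) t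

/-- `c` is parametrized by arc length on `J`, for the rescaled Sasaki type metric. -/
def IsUnitSpeed (g : Metric n M) (f : M → ℝ) {p q : ℕ} (J : Set ℝ)
    (c : ℝ → TensorBundle n M p q) : Prop :=
  ∀ e ∈ IsManifold.maximalAtlas (𝓡 n) ∞ M, ∀ t ∈ J, proj (c t) ∈ e.source →
    sasaki g f e (bundleCoord e (c t))
      (fun a => deriv (fun s => bundleCoord e (c s) a) t)
      (fun a => deriv (fun s => bundleCoord e (c s) a) t) = 1

/-- The tensor field along the projection of `c` that `c` defines has vanishing second covariant
derivative on `J`. -/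
def HasVanishingSecondCovDeriv (g : Metric n M) {p q : ℕ} (J : Set ℝ)
    (c : ℝ → TensorBundle n M p q) : Prop :=
  ∀ e ∈ IsManifold.maximalAtlas (𝓡 n) ∞ M, ∀ t ∈ J, proj (c t) ∈ e.source →
    covDeriv g e (fun s => proj (c s))
      (covDeriv g e (fun s => proj (c s)) (fun s => components e (c s))) t = 0

end Manifold

end RescaledSasaki

end

noncomputable section

set_option linter.unusedSectionVars false

/-! Lowering an index turns the acceleration of a metric connection with torsion into Euler–Lagrange
form: for a curve `X` with velocity `v` and a fixed coordinate vector `w`, `G(∇_v v, w) = d/ds G(v,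
w) - (1/2) ∂_w G(v, v) + G(T(w, v), v)` (`bil_acceleration`). Neither the inverse of the Sasaki
matrix nor the connection coefficients on the bundle are ever computed; it suffices to test the
acceleration against vertical and horizontal lifts.

Let `B = δt/ds` be the vertical part of the velocity. Against a vertical lift of `A`, the torsion
term vanishes, and compatibility of `∇` with the scalar product of tensors leaves `G(δ²t/ds², A)`.
Hence the vertical part of the acceleration is `δ²t/ds²` (`verticalPart_acceleration`), which gives
claim 1. Against a horizontal lift of `ξ`, one finds the Euler–Lagrange expression of the conformal
metric `f g` on `M`, plus terms pairing `B` with derivatives and products of connection forms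
applied to `t`. By the structure equation these terms add up to minus the pairing of `B` with the
curvature acting on `t`, and the prescribed torsion cancels them exactly. Hence the base part of the
acceleration is that of the Levi-Civita connection of `f g` (`basePart_acceleration`).

So a geodesic upstairs is a geodesic of `f g` carrying a tensor field with `δ²t/ds² = 0`. If `f` is
constant, then `f g` and `g` have the same geodesics. Conversely, a geodesic of `f g` starting in
any direction, with unit speed for `f g`, lifts through the zero section to an arc-length geodesic
of the bundle (`exists_isBundleGeodesic_isUnitSpeed`). If its projection is also a geodesic of `g`,
comparing the two Euler–Lagrange equations tested on the velocity gives `df(v) g(v, v) = 0`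
(`fderiv_eq_zero_of_acceleration`). Hence `df = 0`, and `f` is constant by connectedness. -/

namespace RescaledSasaki

/-! ### Bilinear forms and the Euler–Lagrange form of the acceleration. -/

section CoordinateLemmas

variable {κ : Type*} [Fintype κ] [DecidableEq κ]

/-- The bilinear form with matrix `G`. -/
def bil (G : Matrix κ κ ℝ) (v w : κ → ℝ) : ℝ := ∑ a, ∑ b, G a b * v a * w b

/-- The velocity of a curve in the coordinate domain. -/
def velocity (X : ℝ → κ → ℝ) (s : ℝ) : κ → ℝ := fun a => deriv (fun r => X r a) s

/-- The components of `∇_{X'} X'`. -/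
def acceleration (Γ : (κ → ℝ) → κ → κ → κ → ℝ) (X : ℝ → κ → ℝ) (t : ℝ) : κ → ℝ := fun c =>
  deriv (fun r => velocity X r c) t + ∑ a, ∑ b, Γ (X t) c a b * velocity X t a * velocity X t b

omit [DecidableEq κ] in
theorem geodesicEquation_iff (Γ : (κ → ℝ) → κ → κ → κ → ℝ) (X : ℝ → κ → ℝ) (t : ℝ) :
    GeodesicEquation Γ X t ↔ acceleration Γ X t = 0 :=
  funext_iff.symm

omit [DecidableEq κ] in
theorem bil_add_left (G : Matrix κ κ ℝ) (v v' w : κ → ℝ) :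
    bil G (v + v') w = bil G v w + bil G v' w := by
  simp [bil, mul_add, add_mul, Finset.sum_add_distrib]

omit [DecidableEq κ] in
theorem bil_smul_left (G : Matrix κ κ ℝ) (r : ℝ) (v w : κ → ℝ) :
    bil G (r • v) w = r * bil G v w := by
  simp only [bil, Pi.smul_apply, smul_eq_mul, Finset.mul_sum]
  exact Finset.sum_congr rfl fun _ _ => Finset.sum_congr rfl fun _ _ => by ring

omit [DecidableEq κ] in
theorem bil_comm {G : Matrix κ κ ℝ} (hG : G.IsSymm) (v w : κ → ℝ) :
    bil G v w = bil G w v := by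
  rw [bil, bil, Finset.sum_comm]
  exact Finset.sum_congr rfl fun a _ => Finset.sum_congr rfl fun b _ => by
    rw [hG.apply]; ring

omit [DecidableEq κ] in
theorem bil_smul_matrix (r : ℝ) (G : Matrix κ κ ℝ) (v w : κ → ℝ) :
    bil (r • G) v w = r * bil G v w := by
  simp only [bil, Matrix.smul_apply, smul_eq_mul, Finset.mul_sum]
  exact Finset.sum_congr rfl fun _ _ => Finset.sum_congr rfl fun _ _ => by ring

theorem bil_single_right (G : Matrix κ κ ℝ) (v : κ → ℝ) (b : κ) :
    bil G v (Pi.single b 1) = Matrix.vecMul v G b := by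
  simp [bil, Pi.single_apply, Matrix.vecMul, dotProduct, mul_comm]

/-- A bilinear form with invertible matrix is nondegenerate. -/
theorem eq_zero_of_bil {G : Matrix κ κ ℝ} (hG : IsUnit G.det) {v : κ → ℝ}
    (h : ∀ w, bil G v w = 0) : v = 0 := by
  have h1 : Matrix.vecMul v G = 0 := funext fun b => by
    rw [← bil_single_right, h]; rfl
  have h2 := congrArg (fun v => Matrix.vecMul v G⁻¹) h1
  simpa [Matrix.vecMul_vecMul, Matrix.mul_nonsing_inv _ hG] using h2

/-- A bilinear form that is nondegenerate on the left has an invertible matrix. -/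
theorem isUnit_det_of_bil {G : Matrix κ κ ℝ} (h : ∀ v, (∀ w, bil G v w = 0) → v = 0) :
    IsUnit G.det := by
  rw [← Matrix.isUnit_iff_isUnit_det, ← Matrix.vecMul_injective_iff_isUnit]
  intro v v' hv
  rw [← sub_eq_zero]
  refine h _ fun w => ?_
  have h0 : Matrix.vecMul (v - v') G = 0 := by
    rw [Matrix.sub_vecMul, sub_eq_zero]; exact hv
  have : bil G (v - v') w = dotProduct (Matrix.vecMul (v - v') G) w := by
    simp only [bil, dotProduct, Matrix.vecMul, Finset.sum_mul]
    rw [Finset.sum_comm]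
    exact Finset.sum_congr rfl fun _ _ => Finset.sum_congr rfl fun _ _ => by ring
  rw [this, h0, zero_dotProduct]

theorem fderiv_eq_sum_pd (F : (κ → ℝ) → ℝ) (z v : κ → ℝ) :
    fderiv ℝ F z v = ∑ c, pd c F z * v c := by
  conv_lhs => rw [pi_eq_sum_univ' v]
  simp [pd, map_sum, mul_comm]

theorem hasDerivAt_comp_curve {F : (κ → ℝ) → ℝ} {X : ℝ → κ → ℝ} {v : κ → ℝ} {t : ℝ}
    (hF : DifferentiableAt ℝ F (X t)) (hX : HasDerivAt X v t) :
    HasDerivAt (fun s => F (X s)) (∑ c, pd c F (X t) * v c) t := by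
  rw [← fderiv_eq_sum_pd]
  exact hF.hasFDerivAt.comp_hasDerivAt t hX

omit [DecidableEq κ] in
theorem hasDerivAt_bil {G : ℝ → Matrix κ κ ℝ} {G' : Matrix κ κ ℝ} {v w : ℝ → κ → ℝ}
    {v' w' : κ → ℝ} {t : ℝ} (hG : ∀ a b, HasDerivAt (fun s => G s a b) (G' a b) t)
    (hv : HasDerivAt v v' t) (hw : HasDerivAt w w' t) :
    HasDerivAt (fun s => bil (G s) (v s) (w s))
      (bil G' (v t) (w t) + bil (G t) v' (w t) + bil (G t) (v t) w') t := by
  have hv := hasDerivAt_pi.1 hv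
  have hw := hasDerivAt_pi.1 hw
  have h := HasDerivAt.fun_sum fun a (_ : a ∈ Finset.univ) =>
    HasDerivAt.fun_sum fun b (_ : b ∈ Finset.univ) => ((hG a b).mul (hv a)).mul (hw b)
  refine h.congr_deriv ?_
  simp only [bil, ← Finset.sum_add_distrib, Pi.mul_apply]
  exact Finset.sum_congr rfl fun _ _ => Finset.sum_congr rfl fun _ _ => by ring

omit [DecidableEq κ] in
theorem hasDerivAt_of_contDiffAt {X : ℝ → κ → ℝ} {t : ℝ} (hX : ContDiffAt ℝ 2 X t) :
    HasDerivAt X (velocity X t) t := by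
  rw [hasDerivAt_pi]
  intro a
  exact ((contDiffAt_pi.1 hX a).differentiableAt (by norm_num)).hasDerivAt

omit [DecidableEq κ] in
theorem hasDerivAt_velocity {X : ℝ → κ → ℝ} {t : ℝ} (hX : ContDiffAt ℝ 2 X t) :
    HasDerivAt (velocity X) (fun a => deriv (fun r => velocity X r a) t) t := by
  rw [hasDerivAt_pi]
  intro a
  have h : ContDiffAt ℝ 1 (deriv fun r => X r a) t := by
    have h2 : ContDiffAt ℝ 1 (fderiv ℝ fun r => X r a) t :=
      (contDiffAt_pi.1 hX a).fderiv_right (by norm_num)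
    exact h2.clm_apply contDiffAt_const
  exact (h.differentiableAt (by norm_num)).hasDerivAt

/-- The covector dual to the acceleration of the metric connection of `G` with torsion `T`, in
Euler–Lagrange form. -/
theorem bil_acceleration (G : (κ → ℝ) → Matrix κ κ ℝ) (hG : ∀ w, (G w).IsSymm)
    (T : (κ → ℝ) → κ → κ → κ → ℝ) (hT : ∀ w c a b, T w c a b = - T w c b a)
    {X : ℝ → κ → ℝ} {t : ℝ} (hdet : IsUnit (G (X t)).det)
    (hd : ∀ a b, DifferentiableAt ℝ (fun z => G z a b) (X t)) (hX : ContDiffAt ℝ 2 X t)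
    (w : κ → ℝ) :
    bil (G (X t)) (acceleration (metricConnection G T) X t) w =
      deriv (fun s => bil (G (X s)) (velocity X s) w) t
      - 1 / 2 * deriv (fun ε : ℝ => bil (G (X t + ε • w)) (velocity X t) (velocity X t)) 0
      + bil (G (X t)) (fun e => ∑ d, ∑ a, T (X t) e d a * w d * velocity X t a)
          (velocity X t) := by
  have hX' := hasDerivAt_of_contDiffAt hX
  set v := velocity X t with hv
  have h1 := hasDerivAt_bil (G := fun s => G (X s)) (fun a b => hasDerivAt_comp_curve (hd a b) hX')
    (hasDerivAt_velocity hX) (hasDerivAt_const t w)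
  -- The variation moves the base point along a straight coordinate line and keeps the velocity
  -- components frozen.
  have hl : HasDerivAt (fun ε : ℝ => X t + ε • w) w 0 := by
    simpa using ((hasDerivAt_id (0 : ℝ)).smul_const w).const_add (X t)
  have h2 := hasDerivAt_bil (t := 0) (G := fun ε : ℝ => G (X t + ε • w))
    (fun a b => hasDerivAt_comp_curve (F := fun z => G z a b) (X := fun ε : ℝ => X t + ε • w)
      (t := 0) (by simpa using hd a b) hl) (hasDerivAt_const 0 v) (hasDerivAt_const 0 v)
  rw [h1.deriv, h2.deriv]
  simp only [zero_smul, add_zero]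
  have z1 : ∀ (M : Matrix κ κ ℝ) u, bil M u 0 = 0 := by simp [bil]
  have z2 : ∀ (M : Matrix κ κ ℝ) u, bil M 0 u = 0 := by simp [bil]
  rw [z1, z2]
  have hacc : acceleration (metricConnection G T) X t =
      (fun a => deriv (fun r => velocity X r a) t) +
      ((fun c => ∑ a, ∑ b, christoffel G (X t) c a b * v a * v b)
      + fun c => ∑ a, ∑ b, contorsion G T (X t) c a b * v a * v b) := by
    funext c
    simp [acceleration, metricConnection, add_mul, Finset.sum_add_distrib, ← hv]
  rw [hacc, bil_add_left, bil_add_left]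
  have lower : ∀ (S : κ → κ → κ → ℝ),
      bil (G (X t)) (fun c => ∑ a, ∑ b, S c a b * v a * v b) w =
      ∑ a, ∑ b, ∑ d, (∑ c, S c a b * G (X t) c d) * v a * v b * w d := by
    intro S
    simp only [bil, Finset.mul_sum, Finset.sum_mul]
    rw [Finset.sum_comm]
    have : ∀ d, ∑ c, ∑ a, ∑ b, G (X t) c d * (S c a b * v a * v b) * w d =
        ∑ a, ∑ b, ∑ c, S c a b * G (X t) c d * v a * v b * w d := by
      intro d
      rw [Finset.sum_comm]
      refine Finset.sum_congr rfl fun a _ => ?_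
      rw [Finset.sum_comm]
      exact Finset.sum_congr rfl fun b _ => Finset.sum_congr rfl fun c _ => by ring
    simp only [this]
    rw [Finset.sum_comm]
    exact Finset.sum_congr rfl fun a _ => Finset.sum_comm
  rw [lower, lower]
  simp only [sum_christoffel_mul G hG _ hdet, sum_contorsion_mul G T _ hdet]
  set D : κ → κ → κ → ℝ := fun a b c => pd a (fun z => G z b c) (X t) with hD
  have e1 : bil (fun a b => ∑ c, pd c (fun z => G z a b) (X t) * v c) v w =
      ∑ a, ∑ b, ∑ d, D a b d * v a * v b * w d := by
    simp only [bil, Finset.sum_mul]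
    rw [Finset.sum_comm_cycle]
  -- Since `v ⊗ v` is symmetric, the first two terms of the Christoffel symbol contract to the same
  -- number.
  have e1' : bil (fun a b => ∑ c, pd c (fun z => G z a b) (X t) * v c) v w =
      ∑ a, ∑ b, ∑ d, D b a d * v a * v b * w d := by
    rw [e1, Finset.sum_comm]
    refine Finset.sum_congr rfl fun a _ => Finset.sum_congr rfl fun b _ =>
      Finset.sum_congr rfl fun d _ => by ring
  have e2 : bil (fun a b => ∑ c, pd c (fun z => G z a b) (X t) * w c) v v =
      ∑ a, ∑ b, ∑ d, D d a b * v a * v b * w d := by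
    simp only [bil, Finset.sum_mul]
    refine Finset.sum_congr rfl fun a _ => Finset.sum_congr rfl fun b _ =>
      Finset.sum_congr rfl fun d _ => by ring
  -- The antisymmetry of `T` in its arguments kills the first contorsion term against `v ⊗ v`.
  have low0 : ∑ a, ∑ b, ∑ d, (∑ e, T (X t) e a b * G (X t) e d) * v a * v b * w d = 0 := by
    have : ∑ a, ∑ b, ∑ d, (∑ e, T (X t) e a b * G (X t) e d) * v a * v b * w d
        = - ∑ a, ∑ b, ∑ d, (∑ e, T (X t) e a b * G (X t) e d) * v a * v b * w d := by
      conv_lhs => rw [Finset.sum_comm]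
      simp only [← Finset.sum_neg_distrib]
      refine Finset.sum_congr rfl fun a _ => Finset.sum_congr rfl fun b _ =>
        Finset.sum_congr rfl fun d _ => ?_
      have : ∑ e, T (X t) e b a * G (X t) e d = - ∑ e, T (X t) e a b * G (X t) e d := by
        rw [← Finset.sum_neg_distrib]
        exact Finset.sum_congr rfl fun e _ => by rw [hT]; ring
      rw [this]; ring
    linarith
  have e3 : bil (G (X t)) (fun e => ∑ d, ∑ a, T (X t) e d a * w d * v a) v =
      ∑ a, ∑ b, ∑ d, (∑ e, T (X t) e d a * G (X t) e b) * v a * v b * w d := by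
    simp only [bil, Finset.mul_sum, Finset.sum_mul]
    rw [Finset.sum_comm]
    have : ∀ b, ∑ c, ∑ d, ∑ a, G (X t) c b * (T (X t) c d a * w d * v a) * v b =
        ∑ a, ∑ d, ∑ c, T (X t) c d a * G (X t) c b * v a * v b * w d := by
      intro b
      rw [Finset.sum_comm_cycle]
      exact Finset.sum_congr rfl fun a _ => by
        rw [Finset.sum_comm]
        exact Finset.sum_congr rfl fun d _ => Finset.sum_congr rfl fun c _ => by ring
    simp only [this]
    rw [Finset.sum_comm]
  -- The other two contorsion terms agree by the symmetry of `v ⊗ v`; their halves add up to one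
  -- full `G(T(w, v), v)`.
  have e3' : bil (G (X t)) (fun e => ∑ d, ∑ a, T (X t) e d a * w d * v a) v =
      ∑ a, ∑ b, ∑ d, (∑ e, T (X t) e d b * G (X t) e a) * v a * v b * w d := by
    rw [e3, Finset.sum_comm]
    refine Finset.sum_congr rfl fun a _ => Finset.sum_congr rfl fun b _ =>
      Finset.sum_congr rfl fun d _ => by ring
  have s1 : ∑ a, ∑ b, ∑ d, 1 / 2 * (D a b d + D b a d - D d a b) * v a * v b * w d =
      1 / 2 * (∑ a, ∑ b, ∑ d, D a b d * v a * v b * w d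
        + ∑ a, ∑ b, ∑ d, D b a d * v a * v b * w d
        - ∑ a, ∑ b, ∑ d, D d a b * v a * v b * w d) := by
    simp only [Finset.mul_sum, ← Finset.sum_add_distrib, ← Finset.sum_sub_distrib]
    refine Finset.sum_congr rfl fun a _ => Finset.sum_congr rfl fun b _ =>
      Finset.sum_congr rfl fun d _ => by ring
  have s2 : ∀ P Q R : κ → κ → κ → ℝ,
      ∑ a, ∑ b, ∑ d, 1 / 2 * (P a b d + Q a b d + R a b d) * v a * v b * w d =
      1 / 2 * (∑ a, ∑ b, ∑ d, P a b d * v a * v b * w d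
        + ∑ a, ∑ b, ∑ d, Q a b d * v a * v b * w d
        + ∑ a, ∑ b, ∑ d, R a b d * v a * v b * w d) := by
    intro P Q R
    simp only [Finset.mul_sum, ← Finset.sum_add_distrib]
    refine Finset.sum_congr rfl fun a _ => Finset.sum_congr rfl fun b _ =>
      Finset.sum_congr rfl fun d _ => by ring
  rw [s1, s2 (fun a b d => ∑ e, T (X t) e a b * G (X t) e d)
    (fun a b d => ∑ e, T (X t) e d a * G (X t) e b)
    (fun a b d => ∑ e, T (X t) e d b * G (X t) e a), low0, ← e1, ← e1', ← e2, ← e3, ← e3']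
  ring

/-- Lets facts on metric connections with torsion be used for the Levi-Civita connection. -/
theorem metricConnection_zero (G : (κ → ℝ) → Matrix κ κ ℝ) :
    metricConnection G 0 = christoffel G := by
  funext z c a b
  simp [metricConnection, contorsion]

/-- The covector dual to the acceleration of the Levi-Civita connection, in Euler–Lagrange form. -/
theorem bil_acceleration_christoffel (G : (κ → ℝ) → Matrix κ κ ℝ) (hG : ∀ w, (G w).IsSymm)
    {X : ℝ → κ → ℝ} {t : ℝ} (hdet : IsUnit (G (X t)).det)
    (hd : ∀ a b, DifferentiableAt ℝ (fun z => G z a b) (X t)) (hX : ContDiffAt ℝ 2 X t)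
    (w : κ → ℝ) :
    bil (G (X t)) (acceleration (christoffel G) X t) w =
      deriv (fun s => bil (G (X s)) (velocity X s) w) t
      - 1 / 2 * deriv (fun ε : ℝ => bil (G (X t + ε • w)) (velocity X t) (velocity X t)) 0 := by
  rw [← metricConnection_zero, bil_acceleration G hG 0 (by simp) hdet hd hX]
  simp [bil]

end CoordinateLemmas


/-! ### The metric in charts and changes of charts. -/

section ChartLemmas

variable {n : ℕ} {M : Type*} [TopologicalSpace M] [ChartedSpace (EuclideanSpace ℝ (Fin n)) M]

/-- The range of the coordinates of the chart `e`. -/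
def coordDomain (e : OpenPartialHomeomorph M (EuclideanSpace ℝ (Fin n))) : Set (Fin n → ℝ) :=
  {x | WithLp.toLp 2 x ∈ e.target}

theorem isOpen_coordDomain (e : OpenPartialHomeomorph M (EuclideanSpace ℝ (Fin n))) :
    IsOpen (coordDomain e) :=
  e.open_target.preimage (PiLp.continuous_toLp 2 _)

theorem coord_mem_coordDomain {e : OpenPartialHomeomorph M (EuclideanSpace ℝ (Fin n))} {y : M}
    (hy : y ∈ e.source) : coord e y ∈ coordDomain e :=
  e.map_source hy

theorem point_mem_source {e : OpenPartialHomeomorph M (EuclideanSpace ℝ (Fin n))}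
    {x : Fin n → ℝ} (hx : x ∈ coordDomain e) : point e x ∈ e.source :=
  e.map_target hx

theorem coord_point {e : OpenPartialHomeomorph M (EuclideanSpace ℝ (Fin n))}
    {x : Fin n → ℝ} (hx : x ∈ coordDomain e) : coord e (point e x) = x := by
  funext i
  simp only [coord, point]
  rw [e.right_inv hx]

theorem point_coord {e : OpenPartialHomeomorph M (EuclideanSpace ℝ (Fin n))} {y : M}
    (hy : y ∈ e.source) : point e (coord e y) = y :=
  e.left_inv hy

variable [IsManifold (𝓡 n) ∞ M]

theorem mdifferentiable_of_mem_maximalAtlas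
    {e : OpenPartialHomeomorph M (EuclideanSpace ℝ (Fin n))}
    (he : e ∈ IsManifold.maximalAtlas (𝓡 n) ∞ M) :
    e.MDifferentiable (𝓡 n) (𝓡 n) :=
  ⟨(contMDiffOn_of_mem_maximalAtlas he).mdifferentiableOn (by simp),
    (contMDiffOn_symm_of_mem_maximalAtlas he).mdifferentiableOn (by simp)⟩

/-- The tangent map of the smooth inverse chart is smooth, and the coordinate field is its value on
a constant field of the model space. -/
theorem contMDiffAt_mfderiv_symm {e : OpenPartialHomeomorph M (EuclideanSpace ℝ (Fin n))}
    (he : e ∈ IsManifold.maximalAtlas (𝓡 n) ∞ M) (v : EuclideanSpace ℝ (Fin n))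
    {u : EuclideanSpace ℝ (Fin n)} (hu : u ∈ e.target) :
    ContMDiffAt (𝓡 n) (𝓡 n).tangent ∞
      (fun u => (⟨e.symm u, mfderiv (𝓡 n) (𝓡 n) e.symm u v⟩ : TangentBundle (𝓡 n) M)) u := by
  have h1 := (contMDiffOn_symm_of_mem_maximalAtlas he).contMDiffOn_tangentMapWithin (m := ∞)
    (by simp) e.open_target.uniqueMDiffOn
  have h2 : ContMDiffAt (𝓡 n) (𝓡 n).tangent ∞
      (fun u => (⟨u, v⟩ : TangentBundle (𝓡 n) (EuclideanSpace ℝ (Fin n)))) u :=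
    contMDiffAt_vectorSpace_iff_contDiffAt.2 contDiffAt_const
  have h3 := (h1.contMDiffAt (x := ⟨u, v⟩) ((e.open_target.preimage
    (FiberBundle.continuous_proj _ _)).mem_nhds hu)).comp u h2
  refine h3.congr_of_eventuallyEq ?_
  filter_upwards [e.open_target.mem_nhds hu] with w hw
  simp only [Function.comp, tangentMapWithin]
  rw [mfderivWithin_of_isOpen e.open_target hw]

/-- The derivative of the inverse of the chart `e`. -/
def symmDeriv (e : OpenPartialHomeomorph M (EuclideanSpace ℝ (Fin n)))
    (u : EuclideanSpace ℝ (Fin n)) : EuclideanSpace ℝ (Fin n) →L[ℝ] EuclideanSpace ℝ (Fin n) :=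
  mfderiv (𝓡 n) (𝓡 n) e.symm u

/-- The metric at `y`, as a bilinear form on the model space. -/
def modelInner (g : Metric n M) (y : M) :
    EuclideanSpace ℝ (Fin n) →L[ℝ] EuclideanSpace ℝ (Fin n) →L[ℝ] ℝ :=
  g.inner y

/-- Removes the round trip `e (e.symm u)` hidden in `frame`. Forgetting the dependence of tangent
spaces on the point is what makes the rewriting possible. -/
theorem metricMatrix_apply (g : Metric n M)
    (e : OpenPartialHomeomorph M (EuclideanSpace ℝ (Fin n)))
    {x : Fin n → ℝ} (hx : x ∈ coordDomain e) (i j : Fin n) :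
    metricMatrix g e x i j = modelInner g (point e x)
      (symmDeriv e (WithLp.toLp 2 x) (EuclideanSpace.single i 1))
      (symmDeriv e (WithLp.toLp 2 x) (EuclideanSpace.single j 1)) :=
  congrArg (fun u => modelInner g (point e x) (symmDeriv e u (EuclideanSpace.single i 1))
    (symmDeriv e u (EuclideanSpace.single j 1))) (e.right_inv hx)

theorem bil_metricMatrix (g : Metric n M) (e : OpenPartialHomeomorph M (EuclideanSpace ℝ (Fin n)))
    {x : Fin n → ℝ} (hx : x ∈ coordDomain e) (v w : Fin n → ℝ) :
    bil (metricMatrix g e x) v w = modelInner g (point e x)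
      (symmDeriv e (WithLp.toLp 2 x) (WithLp.toLp 2 v))
      (symmDeriv e (WithLp.toLp 2 x) (WithLp.toLp 2 w)) := by
  have hs : ∀ u : Fin n → ℝ, (WithLp.toLp 2 u : EuclideanSpace ℝ (Fin n)) =
      ∑ i, u i • EuclideanSpace.single i (1 : ℝ) := by
    intro u
    ext k
    simp [Pi.single_apply]
  rw [hs v, hs w]
  simp only [map_sum, map_smul, bil, metricMatrix_apply g e hx, sum_apply, smul_apply,
    smul_eq_mul, Finset.mul_sum]
  rw [Finset.sum_comm]
  exact Finset.sum_congr rfl fun a _ => Finset.sum_congr rfl fun b _ => by ring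

theorem metricMatrix_isSymm (g : Metric n M)
    (e : OpenPartialHomeomorph M (EuclideanSpace ℝ (Fin n))) (x : Fin n → ℝ) :
    (metricMatrix g e x).IsSymm :=
  Matrix.IsSymm.ext fun _ _ => g.symm _ _ _

/-- The derivative of `e` is a left inverse of that of `e.symm`, so non-zero components give a
non-zero tangent vector, on which `g` is positive. -/
theorem bil_metricMatrix_pos (g : Metric n M)
    {e : OpenPartialHomeomorph M (EuclideanSpace ℝ (Fin n))}
    (he : e ∈ IsManifold.maximalAtlas (𝓡 n) ∞ M) {x : Fin n → ℝ} (hx : x ∈ coordDomain e)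
    {v : Fin n → ℝ} (hv : v ≠ 0) : 0 < bil (metricMatrix g e x) v v := by
  rw [bil_metricMatrix g e hx]
  refine g.pos _ _ fun h0 => hv ?_
  have h0' : symmDeriv e (WithLp.toLp 2 x) (WithLp.toLp 2 v) = 0 := h0
  let L : EuclideanSpace ℝ (Fin n) →L[ℝ] EuclideanSpace ℝ (Fin n) :=
    mfderiv (𝓡 n) (𝓡 n) e (e.symm (WithLp.toLp 2 x))
  have h1 : L (symmDeriv e (WithLp.toLp 2 x) (WithLp.toLp 2 v)) = WithLp.toLp 2 v :=
    congrArg (fun K : EuclideanSpace ℝ (Fin n) →L[ℝ] EuclideanSpace ℝ (Fin n) =>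
      K (WithLp.toLp 2 v)) ((mdifferentiable_of_mem_maximalAtlas he).comp_symm_deriv hx)
  rw [h0', map_zero] at h1
  funext i
  simpa using (congrArg (fun u : EuclideanSpace ℝ (Fin n) => u i) h1).symm

theorem isUnit_det_metricMatrix (g : Metric n M)
    {e : OpenPartialHomeomorph M (EuclideanSpace ℝ (Fin n))}
    (he : e ∈ IsManifold.maximalAtlas (𝓡 n) ∞ M) {x : Fin n → ℝ} (hx : x ∈ coordDomain e) :
    IsUnit (metricMatrix g e x).det := by
  refine isUnit_det_of_bil fun v h => ?_
  by_contra hv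
  exact (bil_metricMatrix_pos g he hx hv).ne' (h v)

/-- Smoothness of `g` as a section of a bundle of bilinear forms is evaluated on two smooth
coordinate fields. -/
theorem contDiffAt_metricMatrix (g : Metric n M)
    {e : OpenPartialHomeomorph M (EuclideanSpace ℝ (Fin n))}
    (he : e ∈ IsManifold.maximalAtlas (𝓡 n) ∞ M) {x : Fin n → ℝ} (hx : x ∈ coordDomain e)
    (i j : Fin n) : ContDiffAt ℝ ∞ (fun z => metricMatrix g e z i j) x := by
  have h : ContMDiffAt (𝓡 n) ((𝓡 n).prod 𝓘(ℝ, ℝ)) ∞ (fun u : EuclideanSpace ℝ (Fin n) =>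
      Bundle.TotalSpace.mk' ℝ (E := Bundle.Trivial M ℝ) (e.symm u)
      (g.inner (e.symm u) (mfderiv (𝓡 n) (𝓡 n) e.symm u (EuclideanSpace.single i 1))
        (mfderiv (𝓡 n) (𝓡 n) e.symm u (EuclideanSpace.single j 1)))) (WithLp.toLp 2 x) := by
    apply ContMDiffAt.clm_bundle_apply₂ (F₁ := EuclideanSpace ℝ (Fin n))
      (F₂ := EuclideanSpace ℝ (Fin n))
    · exact g.contMDiff.contMDiffAt.comp _
        ((contMDiffOn_symm_of_mem_maximalAtlas he).contMDiffAt (e.open_target.mem_nhds hx))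
    · exact contMDiffAt_mfderiv_symm he _ hx
    · exact contMDiffAt_mfderiv_symm he _ hx
  have h1 := (contMDiffAt_iff_contDiffAt.1 (Bundle.contMDiffAt_totalSpace.1 h).2).comp x
    (PiLp.contDiff_toLp (n := ∞) (p := 2) (𝕜 := ℝ)).contDiffAt
  refine h1.congr_of_eventuallyEq ?_
  filter_upwards [(isOpen_coordDomain e).mem_nhds hx] with z hz
  exact metricMatrix_apply g e hz i j

theorem contDiffAt_comp_point {f : M → ℝ} (hf : ContMDiff (𝓡 n) 𝓘(ℝ, ℝ) ∞ f)
    {e : OpenPartialHomeomorph M (EuclideanSpace ℝ (Fin n))}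
    (he : e ∈ IsManifold.maximalAtlas (𝓡 n) ∞ M) {x : Fin n → ℝ} (hx : x ∈ coordDomain e) :
    ContDiffAt ℝ ∞ (fun z => f (point e z)) x := by
  have h := hf.contMDiffAt.comp (WithLp.toLp 2 x)
    ((contMDiffOn_symm_of_mem_maximalAtlas he).contMDiffAt (e.open_target.mem_nhds hx))
  exact (contMDiffAt_iff_contDiffAt.1 h).comp x
    (PiLp.contDiff_toLp (n := ∞) (p := 2) (𝕜 := ℝ)).contDiffAt

/-- The change of coordinates from the chart `e` to the chart `e'`. -/
def transition (e e' : OpenPartialHomeomorph M (EuclideanSpace ℝ (Fin n))) (x : Fin n → ℝ) :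
    Fin n → ℝ :=
  coord e' (point e x)

theorem contDiffAt_transition {e e' : OpenPartialHomeomorph M (EuclideanSpace ℝ (Fin n))}
    (he : e ∈ IsManifold.maximalAtlas (𝓡 n) ∞ M) (he' : e' ∈ IsManifold.maximalAtlas (𝓡 n) ∞ M)
    {x : Fin n → ℝ} (hx : x ∈ coordDomain e) (hx' : point e x ∈ e'.source) :
    ContDiffAt ℝ ∞ (transition e e') x := by
  have h := ((contMDiffOn_of_mem_maximalAtlas he').contMDiffAt
    (e'.open_source.mem_nhds hx')).comp (WithLp.toLp 2 x)
    ((contMDiffOn_symm_of_mem_maximalAtlas he).contMDiffAt (e.open_target.mem_nhds hx))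
  exact (PiLp.contDiff_ofLp (n := ∞) (p := 2) (𝕜 := ℝ)).contDiffAt.comp x
    ((contMDiffAt_iff_contDiffAt.1 h).comp x
      (PiLp.contDiff_toLp (n := ∞) (p := 2) (𝕜 := ℝ)).contDiffAt)

theorem isOpen_transition_source (e e' : OpenPartialHomeomorph M (EuclideanSpace ℝ (Fin n))) :
    IsOpen {x | x ∈ coordDomain e ∧ point e x ∈ e'.source} :=
  (e.isOpen_inter_preimage_symm e'.open_source).preimage (PiLp.continuous_toLp 2 _)

theorem transition_transition {e e' : OpenPartialHomeomorph M (EuclideanSpace ℝ (Fin n))}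
    {x : Fin n → ℝ} (hx : x ∈ coordDomain e) (hx' : point e x ∈ e'.source) :
    transition e' e (transition e e' x) = x := by
  rw [transition, transition, point_coord hx', coord_point hx]

/-- The chain rule for the two inverse changes of coordinates supplies a right inverse. Thus every
test vector in the chart `e'` comes from one in `e`. -/
theorem fderiv_transition_surjective
    {e e' : OpenPartialHomeomorph M (EuclideanSpace ℝ (Fin n))}
    (he : e ∈ IsManifold.maximalAtlas (𝓡 n) ∞ M) (he' : e' ∈ IsManifold.maximalAtlas (𝓡 n) ∞ M)
    {x : Fin n → ℝ} (hx : x ∈ coordDomain e) (hx' : point e x ∈ e'.source) :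
    Function.Surjective (fderiv ℝ (transition e e') x) := by
  have hy : transition e e' x ∈ coordDomain e' := coord_mem_coordDomain hx'
  have hy' : point e' (transition e e' x) ∈ e.source := by
    rw [transition, point_coord hx']; exact point_mem_source hx
  have h1 := ((contDiffAt_transition he he' hx hx').differentiableAt (by simp)).hasFDerivAt
  have h2 := ((contDiffAt_transition he' he hy hy').differentiableAt (by simp)).hasFDerivAt
  rw [← transition_transition hx hx'] at h1
  have h3 := h1.comp _ h2
  have h4 : HasFDerivAt (transition e e' ∘ transition e' e)
      (ContinuousLinearMap.id ℝ (Fin n → ℝ)) (transition e e' x) := by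
    refine (hasFDerivAt_id _).congr_of_eventuallyEq ?_
    filter_upwards [(isOpen_transition_source e' e).mem_nhds ⟨hy, hy'⟩] with z hz
    exact transition_transition hz.1 hz.2
  intro v
  have := congrArg (fun L => L v) (h3.unique h4)
  rw [transition_transition hx hx'] at this
  exact ⟨_, this⟩

/-- The components of the metric are the components of a covariant tensor. -/
theorem bil_metricMatrix_transition (g : Metric n M)
    {e e' : OpenPartialHomeomorph M (EuclideanSpace ℝ (Fin n))}
    (he : e ∈ IsManifold.maximalAtlas (𝓡 n) ∞ M) (he' : e' ∈ IsManifold.maximalAtlas (𝓡 n) ∞ M)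
    {x : Fin n → ℝ} (hx : x ∈ coordDomain e) (hx' : point e x ∈ e'.source) (v w : Fin n → ℝ) :
    bil (metricMatrix g e x) v w = bil (metricMatrix g e' (transition e e' x))
      (fderiv ℝ (transition e e') x v) (fderiv ℝ (transition e e') x w) := by
  have hy : transition e e' x ∈ coordDomain e' := coord_mem_coordDomain hx'
  rw [bil_metricMatrix g e hx, bil_metricMatrix g e' hy]
  have hu' : e.symm (WithLp.toLp 2 x) ∈ e'.source := hx'
  have hφ : MDifferentiableAt (𝓡 n) (𝓡 n) (e' ∘ e.symm) (WithLp.toLp 2 x) :=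
    ((mdifferentiable_of_mem_maximalAtlas he').mdifferentiableAt hu').comp _
      ((mdifferentiable_of_mem_maximalAtlas he).mdifferentiableAt_symm hx)
  have hy2 : e' (e.symm (WithLp.toLp 2 x)) ∈ e'.target := hy
  -- Chain rule for `e.symm = e'.symm ∘ (e' ∘ e.symm)`, valid near the point.
  have hd : ∀ v, symmDeriv e (WithLp.toLp 2 x) v =
      symmDeriv e' (e' (e.symm (WithLp.toLp 2 x)))
        (fderiv ℝ (e' ∘ e.symm) (WithLp.toLp 2 x) v) := by
    intro v
    have h1 : (e'.symm ∘ (e' ∘ e.symm)) =ᶠ[nhds (WithLp.toLp 2 x)] e.symm := by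
      filter_upwards [(e.isOpen_inter_preimage_symm e'.open_source).mem_nhds ⟨hx, hu'⟩] with z hz
      exact e'.left_inv hz.2
    have h2 := mfderiv_comp (I := 𝓡 n) (I' := 𝓡 n) (I'' := 𝓡 n) (WithLp.toLp 2 x)
      ((mdifferentiable_of_mem_maximalAtlas he').mdifferentiableAt_symm hy2) hφ
    rw [h1.mfderiv_eq, mfderiv_eq_fderiv] at h2
    exact congrArg (fun K : EuclideanSpace ℝ (Fin n) →L[ℝ] EuclideanSpace ℝ (Fin n) => K v) h2
  have ht : ∀ v, WithLp.toLp 2 (fderiv ℝ (transition e e') x v) =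
      fderiv ℝ (e' ∘ e.symm) (WithLp.toLp 2 x) (WithLp.toLp 2 v) := by
    intro v
    have h1 := (mdifferentiableAt_iff_differentiableAt.1 hφ).hasFDerivAt
    have h2 := (PiLp.continuousLinearEquiv 2 ℝ fun _ : Fin n => ℝ).hasFDerivAt.comp x
      (h1.comp x (PiLp.continuousLinearEquiv 2 ℝ fun _ : Fin n => ℝ).symm.hasFDerivAt)
    have h3 : HasFDerivAt (transition e e') _ x := h2
    rw [h3.fderiv]
    rfl
  have hp : point e' (transition e e' x) = point e x := point_coord hx'
  rw [hp, ht, ht, hd, hd]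
  rfl

end ChartLemmas

/-! ### Endomorphisms acting on multi-indexed families, one index at a time. -/

section SlotAction

variable {ι κ : Type*} [Fintype ι] [DecidableEq ι] [Fintype κ]

/-- The action of an endomorphism with components `φ k m = φ_m^k` on families `A^{i_1 …}`. -/
def slotAct (φ : κ → κ → ℝ) (A : (ι → κ) → ℝ) (i : ι → κ) : ℝ :=
  ∑ a, ∑ m, φ (i a) m * A (Function.update i a m)

theorem slotAct_mul_right (φ : κ → κ → ℝ) (A : (ι → κ) → ℝ) (r : ℝ) (i : ι → κ) :
    slotAct φ (fun i => A i * r) i = slotAct φ A i * r := by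
  simp only [slotAct, Finset.sum_mul, mul_assoc]

theorem slotAct_mul_left (φ : κ → κ → ℝ) (A : (ι → κ) → ℝ) (r : ℝ) (i : ι → κ) :
    slotAct φ (fun i => r * A i) i = r * slotAct φ A i := by
  simp only [slotAct, Finset.mul_sum]
  exact Finset.sum_congr rfl fun _ _ => Finset.sum_congr rfl fun _ _ => by ring

theorem slotAct_add (φ : κ → κ → ℝ) (A B : (ι → κ) → ℝ) (i : ι → κ) :
    slotAct φ (fun i => A i + B i) i = slotAct φ A i + slotAct φ B i := by
  simp only [slotAct, mul_add, Finset.sum_add_distrib]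

theorem slotAct_sum {σ : Type*} (s : Finset σ) (φ : κ → κ → ℝ) (A : σ → (ι → κ) → ℝ)
    (i : ι → κ) : slotAct φ (fun i => ∑ j ∈ s, A j i) i = ∑ j ∈ s, slotAct φ (A j) i := by
  classical
  induction s using Finset.induction_on with
  | empty => simp [slotAct]
  | insert a s ha ih => simp only [Finset.sum_insert ha, slotAct_add, ih]

theorem slotAct_sub_left (φ ψ : κ → κ → ℝ) (A : (ι → κ) → ℝ) (i : ι → κ) :
    slotAct (fun k m => φ k m - ψ k m) A i = slotAct φ A i - slotAct ψ A i := by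
  simp only [slotAct, sub_mul, Finset.sum_sub_distrib]

/-- Actions on different slots commute, so only the terms in which both act on the same slot
survive, and these compose as matrices. -/
theorem slotAct_commutator (φ ψ : κ → κ → ℝ) (A : (ι → κ) → ℝ) (i : ι → κ) :
    slotAct φ (slotAct ψ A) i - slotAct ψ (slotAct φ A) i =
      slotAct (fun k m => ∑ r, φ k r * ψ r m - ∑ r, ψ k r * φ r m) A i := by
  -- The diagonal terms `a = b` give the matrix product; the rest is symmetric under exchanging `φ`
  -- and `ψ`.
  have expand : ∀ φ ψ : κ → κ → ℝ, slotAct φ (slotAct ψ A) i =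
      slotAct (fun k m => ∑ r, φ k r * ψ r m) A i + ∑ a, ∑ b, if a = b then 0 else
        ∑ m, ∑ r, φ (i a) m * ψ (i b) r * A (Function.update (Function.update i a m) b r) := by
    intro φ ψ
    simp only [slotAct, ← Finset.sum_add_distrib]
    refine Finset.sum_congr rfl fun a _ => ?_
    have h1 : ∀ m, ∑ b, ∑ r, ψ (Function.update i a m b) r *
          A (Function.update (Function.update i a m) b r) =
        ∑ r, ψ m r * A (Function.update i a r) + ∑ b, if a = b then 0 else
          ∑ r, ψ (i b) r * A (Function.update (Function.update i a m) b r) := by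
      intro m
      rw [← Finset.add_sum_erase _ _ (Finset.mem_univ a),
        ← Finset.add_sum_erase (a := a) (f := fun b => if a = b then (0 : ℝ) else _) _
          (Finset.mem_univ a)]
      simp only [Function.update_self, Function.update_idem, if_true, zero_add]
      congr 1
      refine Finset.sum_congr rfl fun b hb => ?_
      have hab : b ≠ a := Finset.ne_of_mem_erase hb
      rw [if_neg hab.symm, Function.update_of_ne hab]
    simp only [h1, mul_add, Finset.sum_add_distrib]
    congr 1
    · simp only [Finset.mul_sum, Finset.sum_mul]
      rw [Finset.sum_comm]
      exact Finset.sum_congr rfl fun _ _ => Finset.sum_congr rfl fun _ _ => by ring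
    · simp only [Finset.mul_sum]
      rw [Finset.sum_comm]
      refine Finset.sum_congr rfl fun b _ => ?_
      by_cases hab : a = b
      · simp [hab]
      · simp only [if_neg hab, Finset.mul_sum, mul_assoc]
  rw [expand φ ψ, expand ψ φ, slotAct_sub_left]
  have : (∑ a, ∑ b, if a = b then (0 : ℝ) else
        ∑ m, ∑ r, φ (i a) m * ψ (i b) r * A (Function.update (Function.update i a m) b r)) =
      ∑ a, ∑ b, if a = b then 0 else
        ∑ m, ∑ r, ψ (i a) m * φ (i b) r * A (Function.update (Function.update i a m) b r) := by
    rw [Finset.sum_comm]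
    refine Finset.sum_congr rfl fun b _ => Finset.sum_congr rfl fun a _ => ?_
    by_cases hab : a = b
    · simp [hab]
    · rw [if_neg hab, if_neg (Ne.symm hab), Finset.sum_comm]
      refine Finset.sum_congr rfl fun m _ => Finset.sum_congr rfl fun r _ => ?_
      rw [Function.update_comm hab]
      ring
  rw [this]
  ring

/-- The map exchanging `i a` with `m` is an involution on pairs `(i, m)`. It transfers a substituted
index from one factor to another under a sum. -/
theorem sum_sum_update_swap (a : ι) (K : (ι → κ) → (ι → κ) → ℝ) :
    ∑ i, ∑ m, K i (Function.update i a m) = ∑ i, ∑ m, K (Function.update i a m) i := by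
  simp only [← Fintype.sum_prod_type']
  refine Finset.sum_nbij' (fun x : (ι → κ) × κ => (Function.update x.1 a x.2, x.1 a))
    (fun x : (ι → κ) × κ => (Function.update x.1 a x.2, x.1 a)) ?_ ?_ ?_ ?_ ?_ <;> simp

/-- The components `∏ S_{i_a k_a}` of a tensor power of a bilinear form. -/
def powMatrix (S : Matrix κ κ ℝ) (i k : ι → κ) : ℝ := ∏ a, S (i a) (k a)

omit [Fintype κ] in
theorem powMatrix_update_left (S : Matrix κ κ ℝ) (i k : ι → κ) (a : ι) (m : κ) :
    powMatrix S (Function.update i a m) k =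
      (∏ c ∈ Finset.univ.erase a, S (i c) (k c)) * S m (k a) := by
  rw [powMatrix, ← Finset.mul_prod_erase _ _ (Finset.mem_univ a), mul_comm, Function.update_self]
  congr 1
  exact Finset.prod_congr rfl fun c hc => by
    rw [Function.update_of_ne (Finset.ne_of_mem_erase hc)]

omit [Fintype κ] in
theorem powMatrix_update_right (S : Matrix κ κ ℝ) (i k : ι → κ) (a : ι) (m : κ) :
    powMatrix S i (Function.update k a m) =
      (∏ c ∈ Finset.univ.erase a, S (i c) (k c)) * S (i a) m := by
  rw [powMatrix, ← Finset.mul_prod_erase _ _ (Finset.mem_univ a), mul_comm, Function.update_self]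
  congr 1
  exact Finset.prod_congr rfl fun c hc => by
    rw [Function.update_of_ne (Finset.ne_of_mem_erase hc)]

/-- Leibniz rule, each differentiated factor substituting one index. With `S` and `ψ` abstract it
serves both the metric (`ψ` the connection matrix) and its inverse (`ψ` minus the transpose). -/
theorem hasDerivAt_powMatrix {S : ℝ → Matrix κ κ ℝ} {ψ : κ → κ → ℝ} {t : ℝ}
    (hS : ∀ b d, HasDerivAt (fun s => S s b d) (∑ m, (ψ m b * S t m d + ψ m d * S t b m)) t)
    (i k : ι → κ) :
    HasDerivAt (fun s => powMatrix (S s) i k)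
      (∑ a, ∑ m, (ψ m (i a) * powMatrix (S t) (Function.update i a m) k
        + ψ m (k a) * powMatrix (S t) i (Function.update k a m))) t := by
  have h := HasDerivAt.fun_finsetProd (u := Finset.univ) fun a (_ : a ∈ Finset.univ) =>
    hS (i a) (k a)
  refine h.congr_deriv ?_
  refine Finset.sum_congr rfl fun a _ => ?_
  rw [smul_eq_mul, Finset.mul_sum]
  refine Finset.sum_congr rfl fun m _ => ?_
  rw [powMatrix_update_left, powMatrix_update_right]
  ring

/-- A compatible connection differentiates the contraction of two families by the product rule. -/
theorem hasDerivAt_sum_powMatrix {S : ℝ → Matrix κ κ ℝ} {ψ : κ → κ → ℝ} {t : ℝ}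
    (hS : ∀ b d, HasDerivAt (fun s => S s b d) (∑ m, (ψ m b * S t m d + ψ m d * S t b m)) t)
    {F : ℝ → (ι → κ) → (ι → κ) → ℝ} {F' : (ι → κ) → (ι → κ) → ℝ}
    (hF : ∀ i k, HasDerivAt (fun s => F s i k) (F' i k) t) :
    HasDerivAt (fun s => ∑ i, ∑ k, powMatrix (S s) i k * F s i k)
      (∑ i, ∑ k, powMatrix (S t) i k * (F' i k + slotAct ψ (fun i => F t i k) i
        + slotAct ψ (fun k => F t i k) k)) t := by
  have h := HasDerivAt.fun_sum fun i (_ : i ∈ Finset.univ) =>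
    HasDerivAt.fun_sum fun k (_ : k ∈ Finset.univ) => (hasDerivAt_powMatrix hS i k).mul (hF i k)
  refine h.congr_deriv ?_
  have e1 : ∑ i, ∑ k, (∑ a, ∑ m, ψ m (i a) * powMatrix (S t) (Function.update i a m) k) * F t i k
      = ∑ i, ∑ k, powMatrix (S t) i k * slotAct ψ (fun i => F t i k) i := by
    rw [Finset.sum_comm, Finset.sum_comm (f := fun i k => powMatrix (S t) i k * _)]
    refine Finset.sum_congr rfl fun k _ => ?_
    simp only [slotAct, Finset.sum_mul, Finset.mul_sum]
    rw [Finset.sum_comm, Finset.sum_comm (f := fun i a => ∑ m, powMatrix (S t) i k * _)]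
    refine Finset.sum_congr rfl fun a _ => ?_
    -- The substituted index is moved from the matrix factor to `F`, where it becomes the action of
    -- `ψ`.
    have := sum_sum_update_swap a fun i i' => ψ (i' a) (i a) * powMatrix (S t) i' k * F t i k
    simp only [Function.update_self] at this
    rw [this]
    exact Finset.sum_congr rfl fun _ _ => Finset.sum_congr rfl fun _ _ => by ring
  have e2 : ∑ i, ∑ k, (∑ a, ∑ m, ψ m (k a) * powMatrix (S t) i (Function.update k a m)) * F t i k
      = ∑ i, ∑ k, powMatrix (S t) i k * slotAct ψ (fun k => F t i k) k := by
    refine Finset.sum_congr rfl fun i _ => ?_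
    simp only [slotAct, Finset.sum_mul, Finset.mul_sum]
    rw [Finset.sum_comm, Finset.sum_comm (f := fun k a => ∑ m, powMatrix (S t) i k * _)]
    refine Finset.sum_congr rfl fun a _ => ?_
    have := sum_sum_update_swap a fun k k' => ψ (k' a) (k a) * powMatrix (S t) i k' * F t i k
    simp only [Function.update_self] at this
    rw [this]
    exact Finset.sum_congr rfl fun _ _ => Finset.sum_congr rfl fun _ _ => by ring
  simp only [mul_add, add_mul, Finset.sum_add_distrib]
  rw [← e1, ← e2]
  ring

/-- A sum over multi-indices of a product is a product of sums, so tensor powers of inverse matrices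
are inverse. -/
theorem sum_powMatrix_mul [DecidableEq κ] {S S' : Matrix κ κ ℝ} (h : S * S' = 1) (i l : ι → κ) :
    ∑ k, powMatrix S i k * powMatrix S' k l = if i = l then 1 else 0 := by
  have h1 : ∑ k, powMatrix S i k * powMatrix S' k l =
      ∏ a, ∑ m, S (i a) m * S' m (l a) := by
    rw [Finset.prod_univ_sum]
    simp only [powMatrix, Finset.prod_mul_distrib, Fintype.piFinset_univ]
  have h2 : ∀ a, ∑ m, S (i a) m * S' m (l a) = if i a = l a then 1 else 0 := fun a => by
    rw [← Matrix.mul_apply, h, Matrix.one_apply]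
  rw [h1]
  simp only [h2]
  split_ifs with hil
  · simp [hil]
  · obtain ⟨a, ha⟩ := Function.ne_iff.1 hil
    exact Finset.prod_eq_zero (Finset.mem_univ a) (if_neg ha)

end SlotAction

/-! ### The action of endomorphisms on components of mixed tensors. -/

section Act

variable {n p q : ℕ}

/-- Lower indices carry the dual action, by minus the transpose, so both kinds of index reduce to
`slotAct`. -/
theorem act_eq_slotAct (φ : Fin n → Fin n → ℝ) (A : Components n p q) (i : Fin p → Fin n)
    (j : Fin q → Fin n) : act φ A i j =
      slotAct φ (fun i => A i j) i + slotAct (fun k m => - φ m k) (fun j => A i j) j := by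
  simp [act, slotAct, sub_eq_add_neg]

theorem act_add (φ : Fin n → Fin n → ℝ) (A B : Components n p q) :
    act φ (A + B) = act φ A + act φ B := by
  funext i j
  simp only [act_eq_slotAct, Pi.add_apply, slotAct_add]
  ring

theorem act_smul (φ : Fin n → Fin n → ℝ) (r : ℝ) (A : Components n p q) :
    act φ (r • A) = r • act φ A := by
  funext i j
  simp only [act_eq_slotAct, Pi.smul_apply, smul_eq_mul, slotAct_mul_left]
  ring

theorem act_add_left (φ ψ : Fin n → Fin n → ℝ) (A : Components n p q) :
    act (φ + ψ) A = act φ A + act ψ A := by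
  funext i j
  simp only [act, Pi.add_apply, add_mul, Finset.sum_add_distrib]
  ring

theorem act_smul_left (r : ℝ) (φ : Fin n → Fin n → ℝ) (A : Components n p q) :
    act (r • φ) A = r • act φ A := by
  funext i j
  simp only [act, Pi.smul_apply, smul_eq_mul, mul_sub, Finset.mul_sum, mul_assoc]

theorem act_neg (φ : Fin n → Fin n → ℝ) (A : Components n p q) :
    act φ (-A) = - act φ A := by
  rw [← neg_one_smul ℝ A, act_smul, neg_one_smul]

theorem act_sub_left (φ ψ : Fin n → Fin n → ℝ) (A : Components n p q) :
    act (φ - ψ) A = act φ A - act ψ A := by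
  rw [sub_eq_add_neg, ← neg_one_smul ℝ ψ, act_add_left, act_smul_left, neg_one_smul,
    ← sub_eq_add_neg]

/-- The action of endomorphisms on tensors is a representation of Lie algebras. -/
theorem act_commutator (φ ψ : Fin n → Fin n → ℝ) (A : Components n p q) :
    act φ (act ψ A) - act ψ (act φ A) =
      act (fun k m => ∑ r, φ k r * ψ r m - ∑ r, ψ k r * φ r m) A := by
  funext i j
  have h1 := slotAct_commutator φ ψ (fun i => A i j) i
  have h2 := slotAct_commutator (fun k m => - φ m k) (fun k m => - ψ m k) (fun j => A i j) j
  -- Actions on upper and on lower indices commute, which removes the mixed terms.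
  have h3 : ∀ φ ψ : Fin n → Fin n → ℝ,
      slotAct φ (fun i => slotAct (fun k m => - ψ m k) (fun j => A i j) j) i =
      slotAct (fun k m => - ψ m k) (fun j => slotAct φ (fun i => A i j) i) j := by
    intro φ ψ
    rw [show (fun i => slotAct (fun k m => - ψ m k) (fun j => A i j) j) = fun i =>
      ∑ b, ∑ m, -ψ m (j b) * A i (Function.update j b m) from rfl]
    simp only [slotAct_sum, slotAct_mul_left]
    rfl
  simp only [Pi.sub_apply, act_eq_slotAct, slotAct_add]
  rw [h3 φ ψ, h3 ψ φ]
  -- The commutator of minus transposes is minus the transpose of the commutator.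
  have h4 : (fun k m => ∑ r, -φ r k * -ψ m r - ∑ r, -ψ r k * -φ m r) =
      fun k m => -(∑ r, φ m r * ψ r k - ∑ r, ψ m r * φ r k) := by
    funext k m
    simp only [← Finset.sum_sub_distrib, ← Finset.sum_neg_distrib]
    exact Finset.sum_congr rfl fun _ _ => by ring
  rw [h4] at h2
  rw [← h1, ← h2]
  unfold slotAct
  ring

theorem hasDerivAt_act {φ : ℝ → Fin n → Fin n → ℝ} {φ' : Fin n → Fin n → ℝ}
    {A : ℝ → Components n p q} {A' : Components n p q} {t : ℝ}
    (hφ : HasDerivAt φ φ' t) (hA : HasDerivAt A A' t) :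
    HasDerivAt (fun s => act (φ s) (A s)) (act φ' (A t) + act (φ t) A') t := by
  have hφ : ∀ k m, HasDerivAt (fun s => φ s k m) (φ' k m) t := fun k m =>
    hasDerivAt_pi.1 (hasDerivAt_pi.1 hφ k) m
  have hA : ∀ i j, HasDerivAt (fun s => A s i j) (A' i j) t := fun k m =>
    hasDerivAt_pi.1 (hasDerivAt_pi.1 hA k) m
  refine hasDerivAt_pi.2 fun i => hasDerivAt_pi.2 fun j => ?_
  have h := (HasDerivAt.fun_sum fun a (_ : a ∈ Finset.univ) =>
    HasDerivAt.fun_sum fun m (_ : m ∈ Finset.univ) =>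
      (hφ (i a) m).mul (hA (Function.update i a m) j)).sub
    (HasDerivAt.fun_sum fun b (_ : b ∈ Finset.univ) =>
    HasDerivAt.fun_sum fun m (_ : m ∈ Finset.univ) =>
      (hφ m (j b)).mul (hA i (Function.update j b m)))
  refine h.congr_deriv ?_
  simp only [act, Pi.add_apply, Finset.sum_add_distrib]
  ring

end Act

/-! ### Smoothness of inverse matrices and Christoffel symbols. -/

section Smoothness

variable {κ : Type*} [Fintype κ] [DecidableEq κ] {E : Type*} [NormedAddCommGroup E]
  [NormedSpace ℝ E] {k : WithTop ℕ∞}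

theorem contDiffAt_det {G : E → Matrix κ κ ℝ} {x : E}
    (hG : ∀ a b, ContDiffAt ℝ k (fun z => G z a b) x) : ContDiffAt ℝ k (fun z => (G z).det) x := by
  simp only [Matrix.det_apply']
  exact ContDiffAt.sum fun σ _ => contDiffAt_const.mul (contDiffAt_prod fun a _ => hG _ _)

/-- Cramer's rule: an entry of the inverse is a determinant with one constant row, divided by a
non-zero determinant. -/
theorem contDiffAt_inv_apply {G : E → Matrix κ κ ℝ} {x : E}
    (hG : ∀ a b, ContDiffAt ℝ k (fun z => G z a b) x) (hx : IsUnit (G x).det) (a b : κ) :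
    ContDiffAt ℝ k (fun z => (G z)⁻¹ a b) x := by
  simp only [Matrix.inv_def, Matrix.smul_apply, Ring.inverse_eq_inv', smul_eq_mul,
    Matrix.adjugate_apply]
  refine ((contDiffAt_det hG).inv hx.ne_zero).mul (contDiffAt_det fun c d => ?_)
  by_cases hc : c = b
  · subst hc
    simp only [Matrix.updateRow_self]
    exact contDiffAt_const
  · simp only [Matrix.updateRow_ne hc]
    exact hG c d

theorem contDiffAt_pd {F : (κ → ℝ) → ℝ} {x : κ → ℝ} (hF : ContDiffAt ℝ ∞ F x) (a : κ) :
    ContDiffAt ℝ ∞ (pd a F) x :=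
  (hF.fderiv_right (m := ∞) (by simp)).clm_apply contDiffAt_const

theorem contDiffAt_christoffel {G : (κ → ℝ) → Matrix κ κ ℝ} {x : κ → ℝ}
    (hG : ∀ a b, ContDiffAt ℝ ∞ (fun z => G z a b) x) (hx : IsUnit (G x).det) (c a b : κ) :
    ContDiffAt ℝ ∞ (fun z => christoffel G z c a b) x :=
  contDiffAt_const.mul (ContDiffAt.sum fun d _ => (contDiffAt_inv_apply hG hx c d).mul
    (((contDiffAt_pd (hG b d) a).add (contDiffAt_pd (hG a d) b)).sub (contDiffAt_pd (hG a b) d)))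

end Smoothness

/-! ### Compatibility of the Levi-Civita connection with the metric on tensors. -/

section Connection

variable {n p q : ℕ} {M : Type*} [TopologicalSpace M]
  [ChartedSpace (EuclideanSpace ℝ (Fin n)) M] [IsManifold (𝓡 n) ∞ M]
  (g : Metric n M) {e : OpenPartialHomeomorph M (EuclideanSpace ℝ (Fin n))}

/-- The endomorphism `ξ^l Γ^k_{lm}` of the connection form. -/
def connMatrix (e : OpenPartialHomeomorph M (EuclideanSpace ℝ (Fin n))) (x ξ : Fin n → ℝ)
    (k m : Fin n) : ℝ :=
  ∑ l, ξ l * baseChristoffel g e x k l m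

/-- The derivative in the direction `v` of the connection form, evaluated on `ξ`. -/
def connDeriv (e : OpenPartialHomeomorph M (EuclideanSpace ℝ (Fin n))) (x v ξ : Fin n → ℝ)
    (k m : Fin n) : ℝ :=
  ∑ l, ξ l * ∑ a, pd a (fun z => baseChristoffel g e z k l m) x * v a

theorem connMatrix_add (x ξ η : Fin n → ℝ) :
    connMatrix g e x (ξ + η) = connMatrix g e x ξ + connMatrix g e x η := by
  funext k m
  simp [connMatrix, add_mul, Finset.sum_add_distrib]

theorem connMatrix_smul (x ξ : Fin n → ℝ) (r : ℝ) :
    connMatrix g e x (r • ξ) = r • connMatrix g e x ξ := by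
  funext k m
  simp [connMatrix, Finset.mul_sum, mul_assoc]

variable (he : e ∈ IsManifold.maximalAtlas (𝓡 n) ∞ M)
include he

theorem contDiffAt_baseChristoffel {x : Fin n → ℝ} (hx : x ∈ coordDomain e) (c a b : Fin n) :
    ContDiffAt ℝ ∞ (fun z => baseChristoffel g e z c a b) x :=
  contDiffAt_christoffel (contDiffAt_metricMatrix g he hx) (isUnit_det_metricMatrix g he hx) c a b

theorem hasDerivAt_connMatrix {x ξ : ℝ → Fin n → ℝ} {v ξ' : Fin n → ℝ} {t : ℝ}
    (ht : x t ∈ coordDomain e) (hx : HasDerivAt x v t) (hξ : HasDerivAt ξ ξ' t) :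
    HasDerivAt (fun s => connMatrix g e (x s) (ξ s))
      (connMatrix g e (x t) ξ' + connDeriv g e (x t) v (ξ t)) t := by
  refine hasDerivAt_pi.2 fun k => hasDerivAt_pi.2 fun m => ?_
  have h := HasDerivAt.fun_sum fun l (_ : l ∈ Finset.univ) => (hasDerivAt_pi.1 hξ l).mul
    (hasDerivAt_comp_curve
      ((contDiffAt_baseChristoffel g he ht k l m).differentiableAt (by simp)) hx)
  refine h.congr_deriv ?_
  simp only [Finset.sum_add_distrib, Pi.add_apply, connMatrix, connDeriv]

/-- This is `∇g = 0` contracted with the velocity, in the form required by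
`hasDerivAt_sum_powMatrix`. -/
theorem hasDerivAt_metricMatrix {x : ℝ → Fin n → ℝ} {v : Fin n → ℝ} {t : ℝ}
    (ht : x t ∈ coordDomain e) (hx : HasDerivAt x v t) (b d : Fin n) :
    HasDerivAt (fun s => metricMatrix g e (x s) b d)
      (∑ m, (connMatrix g e (x t) v m b * metricMatrix g e (x t) m d
        + connMatrix g e (x t) v m d * metricMatrix g e (x t) b m)) t := by
  have h := hasDerivAt_comp_curve
    ((contDiffAt_metricMatrix g he ht b d).differentiableAt (by simp)) hx
  refine h.congr_deriv ?_
  have hm : ∀ a, pd a (fun z => metricMatrix g e z b d) (x t) =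
      ∑ c, baseChristoffel g e (x t) c a b * metricMatrix g e (x t) c d
      + ∑ c, baseChristoffel g e (x t) c a d * metricMatrix g e (x t) b c := by
    intro a
    have := metricConnection_metric (metricMatrix g e) (metricMatrix_isSymm g e) 0 (by simp) (x t)
      (isUnit_det_metricMatrix g he ht) a b d
    rw [metricConnection_zero] at this
    simp only [baseChristoffel]
    linarith
  simp only [hm, connMatrix, Finset.sum_mul, ← Finset.sum_add_distrib]
  rw [Finset.sum_comm]
  exact Finset.sum_congr rfl fun _ _ => Finset.sum_congr rfl fun _ _ => by ring

/-- Differentiating `G⁻¹ G = 1` and inserting the derivative of `G` determines the derivative of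
`G⁻¹`. -/
theorem hasDerivAt_metricMatrix_inv {x : ℝ → Fin n → ℝ} {v : Fin n → ℝ} {t : ℝ}
    (ht : x t ∈ coordDomain e) (hx : HasDerivAt x v t) (b d : Fin n) :
    HasDerivAt (fun s => (metricMatrix g e (x s))⁻¹ b d)
      (∑ m, (- connMatrix g e (x t) v b m * (metricMatrix g e (x t))⁻¹ m d
        + - connMatrix g e (x t) v d m * (metricMatrix g e (x t))⁻¹ b m)) t := by
  have hinv : ∀ b d, HasDerivAt (fun s => (metricMatrix g e (x s))⁻¹ b d)
      (∑ c, pd c (fun z => (metricMatrix g e z)⁻¹ b d) (x t) * v c) t := fun b d =>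
    hasDerivAt_comp_curve ((contDiffAt_inv_apply (contDiffAt_metricMatrix g he ht)
      (isUnit_det_metricMatrix g he ht) b d).differentiableAt (by simp)) hx
  set H' : Matrix (Fin n) (Fin n) ℝ :=
    Matrix.of fun b d => ∑ c, pd c (fun z => (metricMatrix g e z)⁻¹ b d) (x t) * v c with hH'
  set Φ : Matrix (Fin n) (Fin n) ℝ := Matrix.of fun k m => connMatrix g e (x t) v k m with hΦ
  set G := metricMatrix g e (x t) with hG
  have hu : IsUnit G.det := isUnit_det_metricMatrix g he ht
  have hzero : H' * G + G⁻¹ * (Φ.transpose * G + G * Φ) = 0 := by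
    ext b d
    have h1 := HasDerivAt.fun_sum fun m (_ : m ∈ Finset.univ) =>
      (hinv b m).mul (hasDerivAt_metricMatrix g he ht hx m d)
    have h2 : HasDerivAt (fun s => ∑ m, (metricMatrix g e (x s))⁻¹ b m * metricMatrix g e (x s) m d)
        0 t := by
      refine (hasDerivAt_const t ((1 : Matrix (Fin n) (Fin n) ℝ) b d)).congr_of_eventuallyEq ?_
      filter_upwards [hx.continuousAt.preimage_mem_nhds ((isOpen_coordDomain e).mem_nhds ht)]
        with s hs
      rw [← Matrix.mul_apply, Matrix.nonsing_inv_mul _ (isUnit_det_metricMatrix g he hs)]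
    rw [Matrix.zero_apply, ← h1.unique h2]
    simp only [Matrix.add_apply, Matrix.mul_apply, Finset.sum_add_distrib, Matrix.transpose_apply,
      hH', hΦ, Matrix.of_apply, ← hG, mul_comm (connMatrix g e (x t) v _ d)]
  have hsol : H' = -(Φ * G⁻¹) - G⁻¹ * Φ.transpose := by
    have h3 := congrArg (· * G⁻¹) hzero
    simp only [add_mul, mul_add, zero_mul, Matrix.mul_assoc, Matrix.mul_nonsing_inv _ hu,
      Matrix.mul_one] at h3
    rw [← Matrix.mul_assoc G⁻¹ G, Matrix.nonsing_inv_mul _ hu, Matrix.one_mul] at h3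
    rw [eq_sub_iff_add_eq, eq_neg_iff_add_eq_zero, ← h3]
    abel
  refine (hinv b d).congr_deriv ?_
  have h4 := congrFun (congrFun hsol b) d
  rw [hH', Matrix.of_apply] at h4
  rw [h4]
  simp only [Matrix.sub_apply, Matrix.neg_apply, Matrix.mul_apply, Matrix.transpose_apply, hΦ,
    Matrix.of_apply, Finset.sum_add_distrib, neg_mul, Finset.sum_neg_distrib,
    mul_comm (connMatrix g e (x t) v d _)]
  ring

omit he

/-- Nesting the lower-index contraction inside the upper one allows the product rule for
contractions to be applied twice. -/
theorem tensorInner_eq_powMatrix (x : Fin n → ℝ) (A B : Components n p q) :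
    tensorInner g e x A B = ∑ i, ∑ k, powMatrix (metricMatrix g e x) i k *
      ∑ j, ∑ l, powMatrix (metricMatrix g e x)⁻¹ j l * (A i j * B k l) := by
  simp only [tensorInner, powMatrix, Finset.mul_sum]
  exact Finset.sum_congr rfl fun _ _ => Finset.sum_congr rfl fun _ _ =>
    Finset.sum_congr rfl fun _ _ => Finset.sum_congr rfl fun _ _ => by ring

theorem tensorInner_comm (x : Fin n → ℝ) (A B : Components n p q) :
    tensorInner g e x A B = tensorInner g e x B A := by
  have hs := metricMatrix_isSymm g e x
  have hs' : (metricMatrix g e x)⁻¹.IsSymm := by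
    rw [Matrix.IsSymm, Matrix.transpose_nonsing_inv, hs]
  simp only [tensorInner]
  rw [Finset.sum_comm]
  refine Finset.sum_congr rfl fun i _ => Finset.sum_congr rfl fun k _ => ?_
  rw [Finset.sum_comm]
  refine Finset.sum_congr rfl fun j _ => Finset.sum_congr rfl fun l _ => ?_
  simp only [hs.apply _ (i _), hs'.apply _ (j _)]
  ring

theorem tensorInner_add_left (x : Fin n → ℝ) (A A' B : Components n p q) :
    tensorInner g e x (A + A') B = tensorInner g e x A B + tensorInner g e x A' B := by
  simp only [tensorInner, Pi.add_apply, mul_add, add_mul, Finset.sum_add_distrib]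

theorem tensorInner_smul_left (x : Fin n → ℝ) (r : ℝ) (A B : Components n p q) :
    tensorInner g e x (r • A) B = r * tensorInner g e x A B := by
  simp only [tensorInner, Pi.smul_apply, smul_eq_mul, Finset.mul_sum]
  exact Finset.sum_congr rfl fun _ _ => Finset.sum_congr rfl fun _ _ =>
    Finset.sum_congr rfl fun _ _ => Finset.sum_congr rfl fun _ _ => by ring

theorem tensorInner_add_right (x : Fin n → ℝ) (A B B' : Components n p q) :
    tensorInner g e x A (B + B') = tensorInner g e x A B + tensorInner g e x A B' := by
  simp only [tensorInner_comm g x A, tensorInner_add_left]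

theorem tensorInner_zero_right (x : Fin n → ℝ) (A : Components n p q) :
    tensorInner g e x A 0 = 0 := by
  simp [tensorInner]

theorem tensorInner_sub_left (x : Fin n → ℝ) (A A' B : Components n p q) :
    tensorInner g e x (A - A') B = tensorInner g e x A B - tensorInner g e x A' B := by
  rw [sub_eq_add_neg, tensorInner_add_left, ← neg_one_smul ℝ A', tensorInner_smul_left]
  ring

theorem tensorInner_sub_right (x : Fin n → ℝ) (A B B' : Components n p q) :
    tensorInner g e x A (B - B') = tensorInner g e x A B - tensorInner g e x A B' := by
  simp only [tensorInner_comm g x A, tensorInner_sub_left]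

include he

theorem eq_zero_of_tensorInner {x : Fin n → ℝ} (hx : x ∈ coordDomain e) {A : Components n p q}
    (h : ∀ B, tensorInner g e x A B = 0) : A = 0 := by
  have hu := isUnit_det_metricMatrix g he hx
  funext i₀ j₀
  -- The test tensor is the metric dual of the elementary tensor at `(i₀, j₀)`, so pairing with it
  -- reads off `A i₀ j₀`.
  rw [Pi.zero_apply, Pi.zero_apply, ← h fun k l =>
    powMatrix (metricMatrix g e x)⁻¹ k i₀ * powMatrix (metricMatrix g e x) l j₀,
    tensorInner_eq_powMatrix]
  have h1 : ∀ i k, ∑ j, ∑ l, powMatrix (metricMatrix g e x)⁻¹ j l * (A i j *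
      (powMatrix (metricMatrix g e x)⁻¹ k i₀ * powMatrix (metricMatrix g e x) l j₀)) =
      A i j₀ * powMatrix (metricMatrix g e x)⁻¹ k i₀ := by
    intro i k
    have : ∀ j, ∑ l, powMatrix (metricMatrix g e x)⁻¹ j l * (A i j *
        (powMatrix (metricMatrix g e x)⁻¹ k i₀ * powMatrix (metricMatrix g e x) l j₀)) =
        A i j * powMatrix (metricMatrix g e x)⁻¹ k i₀ * ∑ l, powMatrix (metricMatrix g e x)⁻¹ j l *
          powMatrix (metricMatrix g e x) l j₀ := by
      intro j
      rw [Finset.mul_sum]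
      exact Finset.sum_congr rfl fun _ _ => by ring
    simp only [this, sum_powMatrix_mul (Matrix.nonsing_inv_mul _ hu)]
    simp
  have h2 : ∀ i, ∑ k, powMatrix (metricMatrix g e x) i k *
      (A i j₀ * powMatrix (metricMatrix g e x)⁻¹ k i₀) = A i j₀ * if i = i₀ then 1 else 0 := by
    intro i
    rw [← sum_powMatrix_mul (Matrix.mul_nonsing_inv _ hu), Finset.mul_sum]
    exact Finset.sum_congr rfl fun _ _ => by ring
  simp only [h1, h2]
  simp

/-- The Levi-Civita connection is compatible with the scalar product of tensors. -/
theorem hasDerivAt_tensorInner {x : ℝ → Fin n → ℝ} {v : Fin n → ℝ} {t : ℝ}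
    (ht : x t ∈ coordDomain e) (hx : HasDerivAt x v t) {A B : ℝ → Components n p q}
    {A' B' : Components n p q} (hA : HasDerivAt A A' t) (hB : HasDerivAt B B' t) :
    HasDerivAt (fun s => tensorInner g e (x s) (A s) (B s))
      (tensorInner g e (x t) (A' + act (connMatrix g e (x t) v) (A t)) (B t)
        + tensorInner g e (x t) (A t) (B' + act (connMatrix g e (x t) v) (B t))) t := by
  have hA : ∀ i j, HasDerivAt (fun s => A s i j) (A' i j) t := fun k m =>
    hasDerivAt_pi.1 (hasDerivAt_pi.1 hA k) m
  have hB : ∀ i j, HasDerivAt (fun s => B s i j) (B' i j) t := fun k m =>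
    hasDerivAt_pi.1 (hasDerivAt_pi.1 hB k) m
  simp only [tensorInner_eq_powMatrix]
  -- The inner contraction uses the inverse metric and the dual action, the outer one the metric and
  -- the action itself.
  have h1 := fun i k => hasDerivAt_sum_powMatrix (ψ := fun k m => - connMatrix g e (x t) v m k)
    (S := fun s => (metricMatrix g e (x s))⁻¹) (hasDerivAt_metricMatrix_inv g he ht hx)
    fun j l => (hA i j).mul (hB k l)
  have h2 := hasDerivAt_sum_powMatrix (S := fun s => metricMatrix g e (x s))
    (hasDerivAt_metricMatrix g he ht hx) h1
  refine h2.congr_deriv ?_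
  rw [← Finset.sum_add_distrib]
  refine Finset.sum_congr rfl fun i _ => ?_
  rw [← Finset.sum_add_distrib]
  refine Finset.sum_congr rfl fun k _ => ?_
  rw [← mul_add]
  congr 1
  simp only [Pi.mul_apply, slotAct_sum, slotAct_mul_left, slotAct_mul_right,
    ← Finset.sum_add_distrib]
  refine Finset.sum_congr rfl fun j _ => Finset.sum_congr rfl fun l _ => ?_
  simp only [Pi.add_apply, act_eq_slotAct]
  ring

end Connection

/-! ### Algebra of the rescaled Sasaki metric and of its torsion. -/

section Sasaki

variable {n p q : ℕ} {M : Type*} [TopologicalSpace M]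
  [ChartedSpace (EuclideanSpace ℝ (Fin n)) M] [IsManifold (𝓡 n) ∞ M]
  (g : Metric n M) (f : M → ℝ) {e : OpenPartialHomeomorph M (EuclideanSpace ℝ (Fin n))}

/-- The components of the conformal metric `f g`. -/
def scaledMatrix (e : OpenPartialHomeomorph M (EuclideanSpace ℝ (Fin n))) (x : Fin n → ℝ) :
    Matrix (Fin n) (Fin n) ℝ :=
  f (point e x) • metricMatrix g e x

theorem scaledMatrix_isSymm (x : Fin n → ℝ) : (scaledMatrix g f e x).IsSymm :=
  (metricMatrix_isSymm g e x).smul _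

theorem bil_scaledMatrix (x v w : Fin n → ℝ) :
    bil (scaledMatrix g f e x) v w = f (point e x) * bil (metricMatrix g e x) v w :=
  bil_smul_matrix _ _ _ _

theorem isUnit_det_scaledMatrix (he : e ∈ IsManifold.maximalAtlas (𝓡 n) ∞ M)
    (hpos : ∀ x, 0 < f x) {x : Fin n → ℝ} (hx : x ∈ coordDomain e) :
    IsUnit (scaledMatrix g f e x).det := by
  refine isUnit_det_of_bil fun v h => eq_zero_of_bil (isUnit_det_metricMatrix g he hx) fun w => ?_
  have := h w
  rw [bil_scaledMatrix] at this
  exact (mul_eq_zero.1 this).resolve_left (hpos _).ne'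

theorem contDiffAt_scaledMatrix (he : e ∈ IsManifold.maximalAtlas (𝓡 n) ∞ M)
    (hf : ContMDiff (𝓡 n) 𝓘(ℝ, ℝ) ∞ f) {x : Fin n → ℝ} (hx : x ∈ coordDomain e) (i j : Fin n) :
    ContDiffAt ℝ ∞ (fun z => scaledMatrix g f e z i j) x :=
  (contDiffAt_comp_point hf he hx).mul (contDiffAt_metricMatrix g he hx i j)

theorem sasaki_eq (z v w : Idx n p q → ℝ) : sasaki g f e z v w =
    bil (scaledMatrix g f e (basePart z)) (basePart v) (basePart w)
      + tensorInner g e (basePart z) (verticalPart g e z v) (verticalPart g e z w) := by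
  rw [bil_scaledMatrix]
  rfl

theorem verticalPart_eq (z v : Idx n p q → ℝ) : verticalPart g e z v =
    fibrePart v + act (connMatrix g e (basePart z) (basePart v)) (fibrePart z) := rfl

theorem verticalPart_add (z v w : Idx n p q → ℝ) :
    verticalPart g e z (v + w) = verticalPart g e z v + verticalPart g e z w := by
  have h1 : basePart (v + w) = basePart v + basePart w := rfl
  have h2 : fibrePart (v + w) = fibrePart v + fibrePart w := rfl
  rw [verticalPart_eq, h1, h2, connMatrix_add, act_add_left, verticalPart_eq, verticalPart_eq]
  abel

theorem verticalPart_smul (z v : Idx n p q → ℝ) (r : ℝ) :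
    verticalPart g e z (r • v) = r • verticalPart g e z v := by
  have h1 : basePart (r • v) = r • basePart v := rfl
  have h2 : fibrePart (r • v) = r • fibrePart v := rfl
  rw [verticalPart_eq, h1, h2, connMatrix_smul, act_smul_left, verticalPart_eq, smul_add]

theorem sasaki_comm (z v w : Idx n p q → ℝ) : sasaki g f e z v w = sasaki g f e z w v := by
  rw [sasaki_eq, sasaki_eq, bil_comm (scaledMatrix_isSymm g f _), tensorInner_comm]

theorem sasaki_add_left (z v v' w : Idx n p q → ℝ) :
    sasaki g f e z (v + v') w = sasaki g f e z v w + sasaki g f e z v' w := by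
  have h1 : basePart (v + v') = basePart v + basePart v' := rfl
  rw [sasaki_eq, h1, bil_add_left, verticalPart_add, tensorInner_add_left, sasaki_eq, sasaki_eq]
  ring

theorem sasaki_smul_left (z v w : Idx n p q → ℝ) (r : ℝ) :
    sasaki g f e z (r • v) w = r * sasaki g f e z v w := by
  have h1 : basePart (r • v) = r • basePart v := rfl
  rw [sasaki_eq, h1, bil_smul_left, verticalPart_smul, tensorInner_smul_left, sasaki_eq]
  ring

/-- By bilinearity the matrix of values on basis vectors recovers the form, so the general
coordinate lemmas can be read through `sasaki`. -/
theorem bil_sasakiMatrix (z v w : Idx n p q → ℝ) :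
    bil (sasakiMatrix g f e z) v w = sasaki g f e z v w := by
  have hl : ∀ v w, ∑ a, v a * sasaki g f e z (Pi.single a 1) w = sasaki g f e z v w := by
    intro v w
    let L : (Idx n p q → ℝ) →ₗ[ℝ] ℝ :=
      { toFun := fun v => sasaki g f e z v w
        map_add' := fun v v' => sasaki_add_left g f z v v' w
        map_smul' := fun r v => sasaki_smul_left g f z v w r }
    have h := L.pi_apply_eq_sum_univ v
    simp only [smul_eq_mul] at h
    refine Eq.trans (Finset.sum_congr rfl fun a _ => ?_) h.symm
    congr 2
    funext b
    simp [Pi.single_apply, eq_comm]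
  rw [← hl]
  refine Finset.sum_congr rfl fun a _ => ?_
  rw [sasaki_comm, ← hl, Finset.mul_sum]
  refine Finset.sum_congr rfl fun b _ => ?_
  rw [sasakiMatrix, sasaki_comm]
  ring

theorem sasakiMatrix_isSymm (z : Idx n p q → ℝ) : (sasakiMatrix g f e z).IsSymm :=
  Matrix.IsSymm.ext fun _ _ => sasaki_comm g f _ _ _

/-- Vertical test vectors detect only the vertical part; by the companion lemma, horizontal ones
detect only the base part. -/
theorem sasaki_verticalLift_right (z v : Idx n p q → ℝ) (A : Components n p q) :
    sasaki g f e z v (verticalLift A) =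
      tensorInner g e (basePart z) (verticalPart g e z v) A := by
  rw [sasaki_eq, verticalPart_verticalLift]
  simp [bil, verticalLift, basePart_mkIdx]

theorem sasaki_horizontalLift_right (z v : Idx n p q → ℝ) (ξ : Fin n → ℝ) :
    sasaki g f e z v (horizontalLift g e z ξ) =
      bil (scaledMatrix g f e (basePart z)) (basePart v) ξ := by
  rw [sasaki_eq, verticalPart_horizontalLift, tensorInner_zero_right, add_zero]
  rfl

variable {g f}

/-- Once the base part is zero, the connection term vanishes and the vertical part is the fibre part
itself. -/
theorem eq_zero_of_verticalPart {z v : Idx n p q → ℝ} (hb : basePart v = 0)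
    (hv : verticalPart g e z v = 0) : v = 0 := by
  have h0 : connMatrix g e (basePart z) 0 = 0 := by
    funext k m
    simp [connMatrix]
  rw [verticalPart_eq, hb, h0, ← zero_smul ℝ (0 : Fin n → Fin n → ℝ), act_smul_left, zero_smul,
    add_zero] at hv
  funext c
  rcases c with i | ⟨i, j⟩
  · exact congrFun hb i
  · exact congrFun (congrFun hv i) j

/-- Horizontal lifts detect the base part through `f g`, vertical lifts the vertical part through
the tensor metric, and both forms are nondegenerate. -/
theorem isUnit_det_sasakiMatrix (he : e ∈ IsManifold.maximalAtlas (𝓡 n) ∞ M)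
    (hpos : ∀ x, 0 < f x) {z : Idx n p q → ℝ} (hz : basePart z ∈ coordDomain e) :
    IsUnit (sasakiMatrix g f e z).det := by
  refine isUnit_det_of_bil fun v h => ?_
  simp only [bil_sasakiMatrix] at h
  refine eq_zero_of_verticalPart (g := g) (z := z) (e := e) ?_ ?_
  · refine eq_zero_of_bil (isUnit_det_scaledMatrix g f he hpos hz) fun ξ => ?_
    rw [← sasaki_horizontalLift_right, h]
  · refine eq_zero_of_tensorInner g he hz fun A => ?_
    rw [← sasaki_verticalLift_right g f, h]

theorem torsion_antisymm (z : Idx n p q → ℝ) (c a b : Idx n p q) :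
    torsion g e z c a b = - torsion g e z c b a := by
  rcases c with c | ⟨i, j⟩ <;> rcases a with a | a <;> rcases b with b | b <;>
    simp only [torsion, neg_zero]
  have : (fun k m => curvature (baseChristoffel g e) (basePart z) b a m k) =
      (-1 : ℝ) • fun k m => curvature (baseChristoffel g e) (basePart z) a b m k := by
    funext k m
    simp only [curvature, Pi.smul_apply, smul_eq_mul, Finset.sum_sub_distrib]
    ring
  rw [this, act_smul_left]
  simp

/-- The structure equation `R = dω + ω ∧ ω` for the connection form, evaluated on vectors with
constant components. -/
theorem curvature_contract (x w v : Fin n → ℝ) (k m : Fin n) :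
    ∑ l, ∑ r, w l * v r * curvature (baseChristoffel g e) x l r m k =
      connDeriv g e x w v k m - connDeriv g e x v w k m
      + (∑ r, connMatrix g e x w k r * connMatrix g e x v r m
        - ∑ r, connMatrix g e x v k r * connMatrix g e x w r m) := by
  have h1 : connDeriv g e x w v k m = ∑ l, ∑ r, w l * v r *
      pd l (fun z => baseChristoffel g e z k r m) x := by
    simp only [connDeriv, Finset.mul_sum]
    rw [Finset.sum_comm]
    exact Finset.sum_congr rfl fun _ _ => Finset.sum_congr rfl fun _ _ => by ring
  have h2 : connDeriv g e x v w k m = ∑ l, ∑ r, w l * v r *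
      pd r (fun z => baseChristoffel g e z k l m) x := by
    simp only [connDeriv, Finset.mul_sum]
    exact Finset.sum_congr rfl fun _ _ => Finset.sum_congr rfl fun _ _ => by ring
  have h3 : ∑ s, connMatrix g e x w k s * connMatrix g e x v s m = ∑ l, ∑ r, w l * v r *
      ∑ s, baseChristoffel g e x k l s * baseChristoffel g e x s r m := by
    simp only [connMatrix, Finset.mul_sum, Finset.sum_mul]
    rw [Finset.sum_comm_cycle]
    refine Finset.sum_congr rfl fun l _ => ?_
    rw [Finset.sum_comm]
    exact Finset.sum_congr rfl fun r _ => Finset.sum_congr rfl fun s _ => by ring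
  have h4 : ∑ s, connMatrix g e x v k s * connMatrix g e x w s m = ∑ l, ∑ r, w l * v r *
      ∑ s, baseChristoffel g e x k r s * baseChristoffel g e x s l m := by
    simp only [connMatrix, Finset.mul_sum, Finset.sum_mul]
    rw [Finset.sum_comm_cycle, Finset.sum_comm_cycle]
    exact Finset.sum_congr rfl fun l _ => Finset.sum_congr rfl fun r _ =>
      Finset.sum_congr rfl fun s _ => by ring
  rw [h1, h2, h3, h4]
  simp only [← Finset.sum_sub_distrib, ← Finset.sum_add_distrib, curvature]
  refine Finset.sum_congr rfl fun l _ => Finset.sum_congr rfl fun r _ => ?_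
  rw [Finset.sum_sub_distrib]
  ring

/-- The torsion of two vectors depends only on their base parts: it is the vertical lift of their
curvature endomorphism acting on the tensor. -/
theorem torsion_contract (z w v : Idx n p q → ℝ) :
    (fun c => ∑ d, ∑ a, torsion g e z c d a * w d * v a) =
      verticalLift (act (fun k m => ∑ l, ∑ r, basePart w l * basePart v r *
        curvature (baseChristoffel g e) (basePart z) l r m k) (fibrePart z)) := by
  funext c
  rcases c with c | ⟨i, j⟩
  · simp [torsion, verticalLift, mkIdx]
  · simp only [Fintype.sum_sum_type, torsion, zero_mul, Finset.sum_const_zero, add_zero,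
      verticalLift, mkIdx, Sum.elim_inr]
    have hs : ∀ (σ : Finset (Fin n × Fin n)) (c : Fin n × Fin n → ℝ)
        (φ : Fin n × Fin n → Fin n → Fin n → ℝ),
        act (fun k m => ∑ y ∈ σ, c y * φ y k m) (fibrePart z) i j =
          ∑ y ∈ σ, c y * act (φ y) (fibrePart z) i j := by
      intro σ c φ
      induction σ using Finset.induction_on with
      | empty => simp [act]
      | insert a s ha ih =>
        simp only [Finset.sum_insert ha, ← ih]
        have := congrFun (congrFun (act_add_left (c a • φ a)
          (fun k m => ∑ y ∈ s, c y * φ y k m) (fibrePart z)) i) j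
        rw [act_smul_left] at this
        exact this
    simp only [← Fintype.sum_prod_type']
    rw [hs Finset.univ (fun y => basePart w y.1 * basePart v y.2)
      (fun y k m => curvature (baseChristoffel g e) (basePart z) y.1 y.2 m k)]
    exact Finset.sum_congr rfl fun y _ => by simp only [basePart]; ring

theorem hasDerivAt_basePart {X : ℝ → Idx n p q → ℝ} {V : Idx n p q → ℝ} {t : ℝ}
    (hX : HasDerivAt X V t) : HasDerivAt (fun s => basePart (X s)) (basePart V) t :=
  hasDerivAt_pi.2 fun i => hasDerivAt_pi.1 hX (Sum.inl i)

theorem hasDerivAt_fibrePart {X : ℝ → Idx n p q → ℝ} {V : Idx n p q → ℝ} {t : ℝ}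
    (hX : HasDerivAt X V t) : HasDerivAt (fun s => fibrePart (X s)) (fibrePart V) t :=
  hasDerivAt_pi.2 fun i => hasDerivAt_pi.2 fun j => hasDerivAt_pi.1 hX (Sum.inr (i, j))

/-- The vertical part of a vector field along a curve is differentiable. -/
theorem hasDerivAt_verticalPart (he : e ∈ IsManifold.maximalAtlas (𝓡 n) ∞ M)
    {X W : ℝ → Idx n p q → ℝ} {V W' : Idx n p q → ℝ} {t : ℝ}
    (ht : basePart (X t) ∈ coordDomain e) (hX : HasDerivAt X V t) (hW : HasDerivAt W W' t) :
    HasDerivAt (fun s => verticalPart g e (X s) (W s))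
      (fibrePart W' + (act (connMatrix g e (basePart (X t)) (basePart W')
        + connDeriv g e (basePart (X t)) (basePart V) (basePart (W t))) (fibrePart (X t))
        + act (connMatrix g e (basePart (X t)) (basePart (W t))) (fibrePart V))) t :=
  (hasDerivAt_fibrePart hW).add (hasDerivAt_act (hasDerivAt_connMatrix g he
    (x := fun s => basePart (X s)) ht (hasDerivAt_basePart hX) (hasDerivAt_basePart hW))
    (hasDerivAt_fibrePart hX))

theorem differentiableAt_scaledMatrix_curve (he : e ∈ IsManifold.maximalAtlas (𝓡 n) ∞ M)
    (hf : ContMDiff (𝓡 n) 𝓘(ℝ, ℝ) ∞ f) {x ξ η : ℝ → Fin n → ℝ} {v ξ' η' : Fin n → ℝ} {t : ℝ}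
    (ht : x t ∈ coordDomain e) (hx : HasDerivAt x v t) (hξ : HasDerivAt ξ ξ' t)
    (hη : HasDerivAt η η' t) :
    DifferentiableAt ℝ (fun s => bil (scaledMatrix g f e (x s)) (ξ s) (η s)) t :=
  (hasDerivAt_bil (G := fun s => scaledMatrix g f e (x s)) (fun a b => hasDerivAt_comp_curve
    ((contDiffAt_scaledMatrix g f he hf ht a b).differentiableAt (by simp)) hx)
    hξ hη).differentiableAt

end Sasaki

/-! ### Vertical and base parts of the acceleration in the tensor bundle. -/

section Acceleration

variable {n p q : ℕ} {M : Type*} [TopologicalSpace M]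
  [ChartedSpace (EuclideanSpace ℝ (Fin n)) M] [IsManifold (𝓡 n) ∞ M]
  {g : Metric n M} {f : M → ℝ} {e : OpenPartialHomeomorph M (EuclideanSpace ℝ (Fin n))}

theorem act_zero_left (A : Components n p q) : act 0 A = 0 := by
  funext i j
  simp [act]

theorem connMatrix_zero (x : Fin n → ℝ) : connMatrix g e x 0 = 0 := by
  funext k m
  simp [connMatrix]

theorem connDeriv_zero (x ξ : Fin n → ℝ) : connDeriv g e x 0 ξ = 0 := by
  funext k m
  simp [connDeriv]

theorem basePart_zero : basePart (0 : Idx n p q → ℝ) = 0 := rfl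

theorem fibrePart_zero : fibrePart (0 : Idx n p q → ℝ) = 0 := rfl

theorem basePart_verticalLift (A : Components n p q) : basePart (verticalLift A) = 0 := rfl

theorem fibrePart_verticalLift (A : Components n p q) : fibrePart (verticalLift A) = A := rfl

theorem basePart_horizontalLift (z : Idx n p q → ℝ) (ξ : Fin n → ℝ) :
    basePart (horizontalLift g e z ξ) = ξ := rfl

theorem fibrePart_horizontalLift (z : Idx n p q → ℝ) (ξ : Fin n → ℝ) :
    fibrePart (horizontalLift g e z ξ) =
      - act (connMatrix g e (basePart z) ξ) (fibrePart z) := rfl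

theorem contDiff_basePart {r : WithTop ℕ∞} :
    ContDiff ℝ r (basePart : (Idx n p q → ℝ) → Fin n → ℝ) :=
  contDiff_pi.2 fun i => contDiff_apply ℝ ℝ (Sum.inl i)

theorem contDiffAt_verticalPart (he : e ∈ IsManifold.maximalAtlas (𝓡 n) ∞ M)
    {z : Idx n p q → ℝ} (hz : basePart z ∈ coordDomain e) (v : Idx n p q → ℝ)
    (i : Fin p → Fin n) (j : Fin q → Fin n) :
    ContDiffAt ℝ ∞ (fun z => verticalPart g e z v i j) z := by
  have hc : ∀ k m, ContDiffAt ℝ ∞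
      (fun z : Idx n p q → ℝ => connMatrix g e (basePart z) (basePart v) k m) z := fun k m =>
    ContDiffAt.sum fun l _ => contDiffAt_const.mul
      (ContDiffAt.comp (g := fun x => baseChristoffel g e x k l m) z
        (contDiffAt_baseChristoffel g he hz k l m) contDiff_basePart.contDiffAt)
  have hf : ∀ i j, ContDiffAt ℝ ∞ (fun z : Idx n p q → ℝ => fibrePart z i j) z := fun i j =>
    (contDiff_apply ℝ ℝ (Sum.inr (i, j))).contDiffAt
  exact contDiffAt_const.add ((ContDiffAt.sum fun a _ => ContDiffAt.sum fun m _ =>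
    (hc _ _).mul (hf _ _)).sub (ContDiffAt.sum fun a _ => ContDiffAt.sum fun m _ =>
    (hc _ _).mul (hf _ _)))

theorem contDiffAt_sasaki (he : e ∈ IsManifold.maximalAtlas (𝓡 n) ∞ M)
    (hf : ContMDiff (𝓡 n) 𝓘(ℝ, ℝ) ∞ f) {z : Idx n p q → ℝ} (hz : basePart z ∈ coordDomain e)
    (v w : Idx n p q → ℝ) : ContDiffAt ℝ ∞ (fun z => sasaki g f e z v w) z := by
  simp only [sasaki_eq]
  refine ContDiffAt.add ?_ ?_
  · exact ContDiffAt.sum fun a _ => ContDiffAt.sum fun b _ =>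
      ((ContDiffAt.comp (g := fun x => scaledMatrix g f e x a b) z
        (contDiffAt_scaledMatrix g f he hf hz a b)
        contDiff_basePart.contDiffAt).mul contDiffAt_const).mul contDiffAt_const
  · have hG : ∀ a b, ContDiffAt ℝ ∞
        (fun z : Idx n p q → ℝ => metricMatrix g e (basePart z) a b) z :=
      fun a b => ContDiffAt.comp (g := fun x => metricMatrix g e x a b) z
        (contDiffAt_metricMatrix g he hz a b)
        contDiff_basePart.contDiffAt
    exact ContDiffAt.sum fun i _ => ContDiffAt.sum fun k _ => ContDiffAt.sum fun j _ =>
      ContDiffAt.sum fun l _ => (((contDiffAt_prod fun a _ => hG _ _).mul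
        (contDiffAt_prod fun b _ => contDiffAt_inv_apply hG
          (isUnit_det_metricMatrix g he hz) _ _)).mul
        (contDiffAt_verticalPart he hz v i j)).mul (contDiffAt_verticalPart he hz w k l)

/-- The second covariant derivative `δ²t/ds²` of the tensor field `t` along the curve `x`, for
`X = (x,t)`, in coordinates. -/
def secondCovDeriv (g : Metric n M) (e : OpenPartialHomeomorph M (EuclideanSpace ℝ (Fin n)))
    (X : ℝ → Idx n p q → ℝ) (t : ℝ) : Components n p q :=
  (fun i j => deriv (fun s => verticalPart g e (X s) (velocity X s) i j) t)
    + act (connMatrix g e (basePart (X t)) (basePart (velocity X t)))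
      (verticalPart g e (X t) (velocity X t))

variable (he : e ∈ IsManifold.maximalAtlas (𝓡 n) ∞ M) (hf : ContMDiff (𝓡 n) 𝓘(ℝ, ℝ) ∞ f)
  (hpos : ∀ x, 0 < f x) {X : ℝ → Idx n p q → ℝ} {t : ℝ} (hX : ContDiffAt ℝ 2 X t)
  (ht : basePart (X t) ∈ coordDomain e)
include he hf hpos hX ht

/-- The Euler–Lagrange form on the bundle; as the torsion is vertical, it pairs only with the
vertical part of the velocity. -/
theorem sasaki_acceleration (w : Idx n p q → ℝ) :
    sasaki g f e (X t) (acceleration (bundleConnection g f e p q) X t) w =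
      deriv (fun s => sasaki g f e (X s) (velocity X s) w) t
      - 1 / 2 * deriv (fun ε : ℝ =>
        sasaki g f e (X t + ε • w) (velocity X t) (velocity X t)) 0
      + tensorInner g e (basePart (X t)) (verticalPart g e (X t) (velocity X t))
        (act (fun k m => ∑ l, ∑ r, basePart w l * basePart (velocity X t) r *
          curvature (baseChristoffel g e) (basePart (X t)) l r m k) (fibrePart (X t))) := by
  have h := bil_acceleration (sasakiMatrix g f e) (sasakiMatrix_isSymm g f) (torsion g e)
    torsion_antisymm (isUnit_det_sasakiMatrix he hpos ht)
    (fun a b => (contDiffAt_sasaki he hf ht _ _).differentiableAt (by simp)) hX w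
  simp only [bil_sasakiMatrix] at h
  rw [torsion_contract, sasaki_comm g f _ (verticalLift _), sasaki_verticalLift_right] at h
  exact h

/-- Tested on a vertical lift of `A`, the derivative along the curve and the variation both produce
`G(B, Γ_v A)`, with `B` the vertical part of the velocity. The two cancel and leave `G(δ²t/ds², A)`.
-/
theorem verticalPart_acceleration :
    verticalPart g e (X t) (acceleration (bundleConnection g f e p q) X t) =
      secondCovDeriv g e X t := by
  have hX1 := hasDerivAt_of_contDiffAt hX
  have hx := hasDerivAt_basePart hX1
  have hB := hasDerivAt_verticalPart (g := g) he ht hX1 (hasDerivAt_velocity hX)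
  rw [← sub_eq_zero]
  refine eq_zero_of_tensorInner g he ht fun A => ?_
  rw [tensorInner_sub_left, ← sasaki_verticalLift_right g f,
    sasaki_acceleration he hf hpos hX ht, sub_eq_zero]
  have hl : HasDerivAt (fun ε : ℝ => X t + ε • verticalLift A) (verticalLift A) 0 := by
    simpa using ((hasDerivAt_id (0 : ℝ)).smul_const (verticalLift A)).const_add (X t)
  have hb0 : basePart (verticalLift A : Idx n p q → ℝ) = 0 := rfl
  have hbase : ∀ ε : ℝ, basePart (X t + ε • verticalLift A) = basePart (X t) := by
    intro ε
    funext i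
    simp [basePart, verticalLift, mkIdx]
  -- A family `A` with constant components has covariant derivative `Γ_v A`, whence the second term.
  have d1 : deriv (fun s => sasaki g f e (X s) (velocity X s) (verticalLift A)) t =
      tensorInner g e (basePart (X t)) (secondCovDeriv g e X t) A
      + tensorInner g e (basePart (X t)) (verticalPart g e (X t) (velocity X t))
        (act (connMatrix g e (basePart (X t)) (basePart (velocity X t))) A) := by
    simp only [sasaki_verticalLift_right]
    have := hasDerivAt_tensorInner g he (x := fun s => basePart (X s)) ht hx hB
      (hasDerivAt_const t A)
    rw [this.deriv, zero_add]
    congr 3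
    have : (fun i j => deriv (fun s => verticalPart g e (X s) (velocity X s) i j) t) = _ :=
      funext fun i => funext fun j => (hasDerivAt_pi.1 (hasDerivAt_pi.1 hB i) j).deriv
    rw [this]
  -- A vertical variation fixes the base point, so only the tensor argument of the connection term
  -- changes.
  have d2 : deriv (fun ε : ℝ => sasaki g f e (X t + ε • verticalLift A) (velocity X t)
      (velocity X t)) 0 = 2 * tensorInner g e (basePart (X t))
        (verticalPart g e (X t) (velocity X t))
        (act (connMatrix g e (basePart (X t)) (basePart (velocity X t))) A) := by
    simp only [sasaki_eq, hbase]
    rw [deriv_const_add]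
    have hb := hasDerivAt_verticalPart (g := g) he (X := fun ε : ℝ => X t + ε • verticalLift A)
      (t := 0) (by rw [hbase]; exact ht) hl (hasDerivAt_const 0 (velocity X t))
    have := hasDerivAt_tensorInner g he (x := fun _ : ℝ => basePart (X t)) (t := 0) ht
      (hasDerivAt_const 0 _) hb hb
    rw [this.deriv]
    simp only [zero_smul, add_zero, zero_add, basePart_zero, fibrePart_zero, connMatrix_zero,
      basePart_verticalLift, fibrePart_verticalLift, connDeriv_zero, act_zero_left]
    rw [tensorInner_comm, two_mul]
  rw [d1, d2]
  have h0 : (fun k m => ∑ l, ∑ r, basePart (verticalLift A : Idx n p q → ℝ) l *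
      basePart (velocity X t) r * curvature (baseChristoffel g e) (basePart (X t)) l r m k) =
      (0 : ℝ) • (0 : Fin n → Fin n → ℝ) := by
    funext k m
    simp [hb0]
  rw [h0, act_smul_left, zero_smul, tensorInner_zero_right]
  ring

/-- Tested on a horizontal lift, the terms beyond the Euler–Lagrange expression of `f g` form minus
the curvature acting on the tensor, paired with the vertical part of the velocity. The torsion is
chosen to cancel this. -/
theorem basePart_acceleration :
    basePart (acceleration (bundleConnection g f e p q) X t) =
      acceleration (christoffel (scaledMatrix g f e)) (fun s => basePart (X s)) t := by
  have hX1 := hasDerivAt_of_contDiffAt hX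
  have hx := hasDerivAt_basePart hX1
  have hx2 : ContDiffAt ℝ 2 (fun s => basePart (X s)) t :=
    contDiff_basePart.contDiffAt.comp t hX
  have hv := hasDerivAt_velocity hX
  have hB := hasDerivAt_verticalPart (g := g) he ht hX1 hv
  rw [← sub_eq_zero]
  refine eq_zero_of_bil (isUnit_det_scaledMatrix g f he hpos ht) fun ξ => ?_
  rw [sub_eq_add_neg, bil_add_left, ← neg_one_smul ℝ (acceleration _ _ _), bil_smul_left,
    ← sasaki_horizontalLift_right,
    sasaki_acceleration he hf hpos hX ht, bil_acceleration_christoffel _ (scaledMatrix_isSymm g f)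
      (isUnit_det_scaledMatrix g f he hpos ht)
      (fun a b => (contDiffAt_scaledMatrix g f he hf ht a b).differentiableAt (by simp)) hx2]
  set x := fun s => basePart (X s) with hxdef
  set w := horizontalLift g e (X t) ξ with hw
  set v := velocity X t with hvdef
  set B := verticalPart g e (X t) v with hBdef
  set Γv := connMatrix g e (x t) (basePart v) with hΓv
  set Γξ := connMatrix g e (x t) ξ with hΓξ
  set T := fibrePart (X t) with hT
  have hl : HasDerivAt (fun ε : ℝ => X t + ε • w) w 0 := by
    simpa using ((hasDerivAt_id (0 : ℝ)).smul_const w).const_add (X t)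
  have hvfib : fibrePart v = B - act Γv T := by
    rw [hBdef, verticalPart_eq, add_sub_cancel_right]
  -- The vector `w` has constant components and is horizontal only at `X t`; the derivative of its
  -- vertical part along the curve gives the extra term.
  have d1 : deriv (fun s => sasaki g f e (X s) (velocity X s) w) t =
      deriv (fun s => bil (scaledMatrix g f e (x s)) (velocity x s) ξ) t
      + tensorInner g e (x t) B (act (connDeriv g e (x t) (basePart v) ξ) T
          + act Γξ (fibrePart v)) := by
    simp only [sasaki_eq]
    have hV := hasDerivAt_verticalPart (g := g) he ht hX1 (hasDerivAt_const t w)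
    have h1 := hasDerivAt_tensorInner g he (x := x) ht hx hB hV
    have h2 := differentiableAt_scaledMatrix_curve (g := g) (f := f) he hf (x := x) ht hx
      (hasDerivAt_basePart hv) (hasDerivAt_const t ξ)
    have h3 := h2.hasDerivAt.add h1
    refine h3.deriv.trans ?_
    have hV0 : verticalPart g e (X t) w = 0 := verticalPart_horizontalLift g e (X t) ξ
    rw [hV0, tensorInner_zero_right, zero_add, ← zero_smul ℝ (0 : Components n p q), act_smul,
      zero_smul, add_zero, basePart_zero, fibrePart_zero, connMatrix_zero, zero_add, zero_add]
    rfl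
  have d2 : deriv (fun ε : ℝ => sasaki g f e (X t + ε • w) v v) 0 =
      deriv (fun ε : ℝ => bil (scaledMatrix g f e (x t + ε • ξ)) (velocity x t) (velocity x t)) 0
      + 2 * tensorInner g e (x t) B (act (connDeriv g e (x t) ξ (basePart v)) T
          - act Γv (act Γξ T) + act Γξ B) := by
    have hbase : ∀ ε : ℝ, basePart (X t + ε • w) = x t + ε • ξ := fun ε => rfl
    simp only [sasaki_eq, hbase]
    have hlx : HasDerivAt (fun ε : ℝ => x t + ε • ξ) ξ 0 := by
      simpa using ((hasDerivAt_id (0 : ℝ)).smul_const ξ).const_add (x t)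
    have ht0 : x t + (0 : ℝ) • ξ ∈ coordDomain e := by simpa using ht
    have hb := hasDerivAt_verticalPart (g := g) he (X := fun ε : ℝ => X t + ε • w)
      (t := 0) ht0 hl (hasDerivAt_const 0 v)
    have h1 := hasDerivAt_tensorInner g he (x := fun ε : ℝ => x t + ε • ξ) (t := 0) ht0 hlx hb hb
    have h2 := differentiableAt_scaledMatrix_curve (g := g) (f := f) he hf
      (x := fun ε : ℝ => x t + ε • ξ) (t := 0) ht0 hlx (hasDerivAt_const 0 (basePart v))
      (hasDerivAt_const 0 (basePart v))
    have h3 := h2.hasDerivAt.add h1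
    refine h3.deriv.trans ?_
    simp only [zero_smul, add_zero]
    rw [tensorInner_comm, ← two_mul]
    congr 3
    rw [basePart_zero, fibrePart_zero, connMatrix_zero, zero_add, zero_add, hw,
      fibrePart_horizontalLift, basePart_horizontalLift, act_neg, ← sub_eq_add_neg]
  -- The torsion term is rewritten by the structure equation, so that it can be matched with the
  -- extra terms of `d1` and `d2`.
  have hR : (fun k m => ∑ l, ∑ r, basePart w l * basePart v r *
      curvature (baseChristoffel g e) (x t) l r m k) =
      (connDeriv g e (x t) ξ (basePart v) - connDeriv g e (x t) (basePart v) ξ)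
      + fun k m => ∑ r, Γξ k r * Γv r m - ∑ r, Γv k r * Γξ r m :=
    funext fun k => funext fun m => curvature_contract (x t) ξ (basePart v) k m
  rw [d1, d2, hR, act_add_left, ← act_commutator, act_sub_left, hvfib,
    sub_eq_add_neg B, act_add, act_neg]
  simp only [tensorInner_add_right, tensorInner_sub_right, ← sub_eq_add_neg]
  ring

end Acceleration

theorem two_le_infty : (2 : WithTop ℕ∞) ≤ ∞ :=
  WithTop.coe_le_coe.2 (le_top : (2 : ℕ∞) ≤ ⊤)

/-- Being `C²` at a point extends to a neighbourhood by `ContDiffAt.eventually`, which excludes the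
order `∞`. -/
theorem two_ne_infty : (2 : WithTop ℕ∞) ≠ ∞ := fun h =>
  ENat.natCast_ne_top 2 (WithTop.coe_injective h)

/-! ### Geodesics of `g` and of `f g` on the base. -/

section BaseCurves

variable {n : ℕ} {M : Type*} [TopologicalSpace M]
  [ChartedSpace (EuclideanSpace ℝ (Fin n)) M] [IsManifold (𝓡 n) ∞ M]
  {g : Metric n M} {f : M → ℝ} {e : OpenPartialHomeomorph M (EuclideanSpace ℝ (Fin n))}
  (he : e ∈ IsManifold.maximalAtlas (𝓡 n) ∞ M) (hf : ContMDiff (𝓡 n) 𝓘(ℝ, ℝ) ∞ f)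
  (hpos : ∀ x, 0 < f x) {x : ℝ → Fin n → ℝ} {t : ℝ} (hx : ContDiffAt ℝ 2 x t)
  (ht : x t ∈ coordDomain e)
include he hf hpos hx ht

theorem bil_acceleration_scaledMatrix (w : Fin n → ℝ) :
    bil (scaledMatrix g f e (x t)) (acceleration (christoffel (scaledMatrix g f e)) x t) w =
      deriv (fun s => bil (scaledMatrix g f e (x s)) (velocity x s) w) t
      - 1 / 2 * deriv (fun ε : ℝ =>
        bil (scaledMatrix g f e (x t + ε • w)) (velocity x t) (velocity x t)) 0 :=
  bil_acceleration_christoffel _ (scaledMatrix_isSymm g f) (isUnit_det_scaledMatrix g f he hpos ht)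
    (fun a b => (contDiffAt_scaledMatrix g f he hf ht a b).differentiableAt (by simp)) hx w

/-- The energy of a geodesic is constant. -/
theorem hasDerivAt_energy
    (hgeo : acceleration (christoffel (scaledMatrix g f e)) x t = 0) :
    HasDerivAt (fun s => bil (scaledMatrix g f e (x s)) (velocity x s) (velocity x s)) 0 t := by
  have hx1 := hasDerivAt_of_contDiffAt hx
  have hd := fun a b => (contDiffAt_scaledMatrix g f he hf ht a b).differentiableAt
    (n := ∞) (by simp)
  have hS := fun a b => hasDerivAt_comp_curve (hd a b) hx1
  -- Testing on the velocity itself turns the Euler–Lagrange equation into half the derivative of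
  -- the energy.
  have h := bil_acceleration_scaledMatrix (g := g) he hf hpos hx ht (velocity x t)
  have hl : HasDerivAt (fun ε : ℝ => x t + ε • velocity x t) (velocity x t) 0 := by
    simpa using ((hasDerivAt_id (0 : ℝ)).smul_const (velocity x t)).const_add (x t)
  have h1 := hasDerivAt_bil (G := fun s => scaledMatrix g f e (x s)) hS (hasDerivAt_velocity hx)
    (hasDerivAt_const t (velocity x t))
  have h2 := hasDerivAt_bil (G := fun ε : ℝ => scaledMatrix g f e (x t + ε • velocity x t))
    (t := 0) (fun a b => hasDerivAt_comp_curve (F := fun z => scaledMatrix g f e z a b)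
      (X := fun ε : ℝ => x t + ε • velocity x t) (t := 0) (by simpa using hd a b) hl)
    (hasDerivAt_const 0 (velocity x t)) (hasDerivAt_const 0 (velocity x t))
  have h3 := hasDerivAt_bil (G := fun s => scaledMatrix g f e (x s)) hS (hasDerivAt_velocity hx)
    (hasDerivAt_velocity hx)
  rw [hgeo, h1.deriv, h2.deriv] at h
  refine h3.congr_deriv ?_
  have z1 : ∀ (S : Matrix (Fin n) (Fin n) ℝ) u, bil S u 0 = 0 := by simp [bil]
  have z2 : ∀ (S : Matrix (Fin n) (Fin n) ℝ) u, bil S 0 u = 0 := by simp [bil]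
  simp only [zero_smul, add_zero, z1, z2] at h
  rw [bil_comm (scaledMatrix_isSymm g f _) (velocity x t)]
  linarith

/-- If a curve is a geodesic both of `g` and of `f g`, then `f` is stationary along it. -/
theorem fderiv_eq_zero_of_acceleration
    (hgeo : acceleration (christoffel (scaledMatrix g f e)) x t = 0)
    (hgeo' : acceleration (baseChristoffel g e) x t = 0) :
    fderiv ℝ (fun z => f (point e z)) (x t) (velocity x t) *
      bil (metricMatrix g e (x t)) (velocity x t) (velocity x t) = 0 := by
  set v := velocity x t with hv
  have hx1 := hasDerivAt_of_contDiffAt hx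
  have hd := fun a b => (contDiffAt_metricMatrix g he ht a b).differentiableAt (n := ∞) (by simp)
  have hF := ((contDiffAt_comp_point hf he ht).differentiableAt (n := ∞) (by simp)).hasFDerivAt
  have hl : HasDerivAt (fun ε : ℝ => x t + ε • v) v 0 := by
    simpa using ((hasDerivAt_id (0 : ℝ)).smul_const v).const_add (x t)
  have h := bil_acceleration_scaledMatrix (g := g) he hf hpos hx ht v
  have h' := bil_acceleration_christoffel (metricMatrix g e) (metricMatrix_isSymm g e)
    (isUnit_det_metricMatrix g he ht) hd hx v
  have e1 := (hasDerivAt_bil (G := fun s => metricMatrix g e (x s))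
    (fun a b => hasDerivAt_comp_curve (hd a b) hx1) (hasDerivAt_velocity hx)
    (hasDerivAt_const t v)).differentiableAt
  have e2 := (hasDerivAt_bil (G := fun ε : ℝ => metricMatrix g e (x t + ε • v))
    (t := 0) (fun a b => hasDerivAt_comp_curve (F := fun z => metricMatrix g e z a b)
      (X := fun ε : ℝ => x t + ε • v) (t := 0) (by simpa using hd a b) hl)
    (hasDerivAt_const 0 v) (hasDerivAt_const 0 v)).differentiableAt
  have f1 : HasDerivAt (fun s => f (point e (x s))) _ t := hF.comp_hasDerivAt t hx1
  have f2 : HasDerivAt (fun ε : ℝ => f (point e (x t + ε • v))) _ 0 :=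
    HasFDerivAt.comp_hasDerivAt (l := fun z => f (point e z)) (0 : ℝ) (by simpa using hF) hl
  have z2 : ∀ (S : Matrix (Fin n) (Fin n) ℝ) u, bil S 0 u = 0 := by simp [bil]
  rw [hgeo, z2] at h
  rw [show christoffel (metricMatrix g e) = baseChristoffel g e from rfl, hgeo', z2] at h'
  simp only [bil_scaledMatrix] at h
  rw [(f1.fun_mul e1.hasDerivAt).deriv, (f2.fun_mul e2.hasDerivAt).deriv] at h
  simp only [zero_smul, add_zero, ← hv] at h h'
  -- By the product rule, `h` is `f` times `h'` plus `(1 - 1/2) df(v) g(v, v)`; the factor 2 clears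
  -- the half.
  linear_combination -2 * h + 2 * f (point e (x t)) * h'

/-- For constant `f`, the metrics `g` and `f g` have the same geodesics. -/
theorem acceleration_eq_zero_of_const {C : ℝ} (hC : ∀ y, f y = C)
    (hgeo : acceleration (christoffel (scaledMatrix g f e)) x t = 0) :
    acceleration (baseChristoffel g e) x t = 0 := by
  have hd := fun a b => (contDiffAt_metricMatrix g he ht a b).differentiableAt (n := ∞) (by simp)
  have hC0 : C ≠ 0 := by rw [← hC (point e (x t))]; exact (hpos _).ne'
  refine eq_zero_of_bil (isUnit_det_metricMatrix g he ht) fun w => ?_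
  have h := bil_acceleration_scaledMatrix (g := g) he hf hpos hx ht w
  have h' := bil_acceleration_christoffel (metricMatrix g e) (metricMatrix_isSymm g e)
    (isUnit_det_metricMatrix g he ht) hd hx w
  simp only [bil_scaledMatrix, hC, deriv_const_mul_field, hgeo] at h
  have z2 : ∀ (S : Matrix (Fin n) (Fin n) ℝ) u, bil S 0 u = 0 := by simp [bil]
  rw [z2, mul_zero] at h
  rw [baseChristoffel, h']
  apply mul_left_cancel₀ hC0
  linarith

omit hpos hx ht hf in
theorem bil_scaledMatrix_transition
    {e' : OpenPartialHomeomorph M (EuclideanSpace ℝ (Fin n))}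
    (he' : e' ∈ IsManifold.maximalAtlas (𝓡 n) ∞ M) {z : Fin n → ℝ} (hz : z ∈ coordDomain e)
    (hz' : point e z ∈ e'.source) (v w : Fin n → ℝ) :
    bil (scaledMatrix g f e z) v w = bil (scaledMatrix g f e' (transition e e' z))
      (fderiv ℝ (transition e e') z v) (fderiv ℝ (transition e e') z w) := by
  have hp : point e' (transition e e' z) = point e z := point_coord hz'
  rw [bil_scaledMatrix, bil_scaledMatrix, hp, bil_metricMatrix_transition g he he' hz hz']

omit hf hpos in
theorem velocity_transition {e' : OpenPartialHomeomorph M (EuclideanSpace ℝ (Fin n))}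
    (he' : e' ∈ IsManifold.maximalAtlas (𝓡 n) ∞ M) (ht' : point e (x t) ∈ e'.source) :
    velocity (fun s => transition e e' (x s)) t =
      fderiv ℝ (transition e e') (x t) (velocity x t) := by
  have h := ((contDiffAt_transition he he' ht ht').differentiableAt
    (by simp)).hasFDerivAt.comp_hasDerivAt t (hasDerivAt_of_contDiffAt hx)
  exact funext fun a => (hasDerivAt_pi.1 h a).deriv

/-- The geodesic equation does not depend on the chart. -/
theorem acceleration_transition {e' : OpenPartialHomeomorph M (EuclideanSpace ℝ (Fin n))}
    (he' : e' ∈ IsManifold.maximalAtlas (𝓡 n) ∞ M) (ht' : point e (x t) ∈ e'.source)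
    (hgeo : acceleration (christoffel (scaledMatrix g f e)) x t = 0) :
    acceleration (christoffel (scaledMatrix g f e')) (fun s => transition e e' (x s)) t = 0 := by
  set Φ := transition e e' with hΦ
  set y := fun s => Φ (x s) with hy
  have hΦ2 : ContDiffAt ℝ ∞ Φ (x t) := contDiffAt_transition he he' ht ht'
  have hyt : y t ∈ coordDomain e' := coord_mem_coordDomain ht'
  have hy2 : ContDiffAt ℝ 2 y t := (hΦ2.of_le two_le_infty).comp t hx
  have hx1 := hasDerivAt_of_contDiffAt hx
  have hy1 := hasDerivAt_of_contDiffAt hy2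
  have hdom := (isOpen_transition_source e e').mem_nhds ⟨ht, ht'⟩
  have hvel : ∀ᶠ s in nhds t, velocity y s = fderiv ℝ Φ (x s) (velocity x s) := by
    filter_upwards [hx.eventually two_ne_infty, hx1.continuousAt.preimage_mem_nhds hdom]
      with s hs hs'
    exact velocity_transition he hs hs'.1 he' hs'.2
  have hD : HasFDerivAt (fderiv ℝ Φ) (fderiv ℝ (fderiv ℝ Φ) (x t)) (x t) :=
    ((hΦ2.fderiv_right (m := ∞) (by simp)).differentiableAt (by simp)).hasFDerivAt
  have hsymm : IsSymmSndFDerivAt ℝ Φ (x t) := hΦ2.isSymmSndFDerivAt (by simpa using two_le_infty)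
  have hd' := fun a b => (contDiffAt_scaledMatrix g f he' hf hyt a b).differentiableAt
    (n := ∞) (by simp)
  have z1 : ∀ (S : Matrix (Fin n) (Fin n) ℝ) u, bil S u 0 = 0 := by simp [bil]
  have z2 : ∀ (S : Matrix (Fin n) (Fin n) ℝ) u, bil S 0 u = 0 := by simp [bil]
  set v := velocity x t with hv
  have hvt : velocity y t = fderiv ℝ Φ (x t) v := hvel.self_of_nhds
  refine eq_zero_of_bil (isUnit_det_scaledMatrix g f he' hpos hyt) fun w' => ?_
  -- Euler–Lagrange expressions in the two charts are compared on corresponding test vectors.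
  obtain ⟨w, rfl⟩ := fderiv_transition_surjective he he' ht ht' w'
  have hl : HasDerivAt (fun ε : ℝ => x t + ε • w) w 0 := by
    simpa using ((hasDerivAt_id (0 : ℝ)).smul_const w).const_add (x t)
  set W := fderiv ℝ Φ (x t) w with hW
  have hL : HasDerivAt (fun ε : ℝ => y t + ε • W) W 0 := by
    simpa using ((hasDerivAt_id (0 : ℝ)).smul_const W).const_add (y t)
  have h := bil_acceleration_scaledMatrix (g := g) he hf hpos hx ht w
  rw [hgeo, z2] at h
  rw [bil_acceleration_scaledMatrix he' hf hpos hy2 hyt W]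
  -- the derivative along the curve
  have a1 : deriv (fun s => bil (scaledMatrix g f e (x s)) (velocity x s) w) t =
      deriv (fun s => bil (scaledMatrix g f e' (y s)) (velocity y s) (fderiv ℝ Φ (x s) w)) t := by
    refine Filter.EventuallyEq.deriv_eq ?_
    filter_upwards [hvel, hx1.continuousAt.preimage_mem_nhds hdom] with s hs hs'
    rw [hs, bil_scaledMatrix_transition he he' hs'.1 hs'.2]
  have hw1 : HasDerivAt (fun s => fderiv ℝ Φ (x s) w) (fderiv ℝ (fderiv ℝ Φ) (x t) v w) t := by
    have := (hD.comp_hasDerivAt t hx1).clm_apply (hasDerivAt_const t w)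
    simpa using this
  have hS := fun a b => hasDerivAt_comp_curve (F := fun z => scaledMatrix g f e' z a b)
    (hd' a b) hy1
  have a2 := hasDerivAt_bil (G := fun s => scaledMatrix g f e' (y s)) hS (hasDerivAt_velocity hy2)
    hw1
  have a3 := hasDerivAt_bil (G := fun s => scaledMatrix g f e' (y s)) hS (hasDerivAt_velocity hy2)
    (hasDerivAt_const t W)
  -- the derivative in the direction of the variation
  have b1 : deriv (fun ε : ℝ => bil (scaledMatrix g f e (x t + ε • w)) v v) 0 =
      deriv (fun ε : ℝ => bil (scaledMatrix g f e' (Φ (x t + ε • w)))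
        (fderiv ℝ Φ (x t + ε • w) v) (fderiv ℝ Φ (x t + ε • w) v)) 0 := by
    refine Filter.EventuallyEq.deriv_eq ?_
    filter_upwards [hl.continuousAt.preimage_mem_nhds (t := {x | x ∈ coordDomain e ∧
      point e x ∈ e'.source}) (by simpa using hdom)] with s hs
    rw [bil_scaledMatrix_transition he he' hs.1 hs.2]
  have hv1 : HasDerivAt (fun ε : ℝ => fderiv ℝ Φ (x t + ε • w) v)
      (fderiv ℝ (fderiv ℝ Φ) (x t) w v) 0 := by
    have := (HasFDerivAt.comp_hasDerivAt (l := fderiv ℝ Φ) (0 : ℝ) (by simpa using hD) hl).clm_apply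
      (hasDerivAt_const 0 v)
    simpa using this
  have hΦl : HasDerivAt (fun ε : ℝ => Φ (x t + ε • w)) W 0 :=
    HasFDerivAt.comp_hasDerivAt (l := Φ) (0 : ℝ)
      (by simpa using (hΦ2.differentiableAt (by simp)).hasFDerivAt) hl
  have b2 := hasDerivAt_bil (G := fun ε : ℝ => scaledMatrix g f e' (Φ (x t + ε • w)))
    (t := 0) (fun a b => hasDerivAt_comp_curve (F := fun z => scaledMatrix g f e' z a b)
      (X := fun ε : ℝ => Φ (x t + ε • w)) (t := 0) (by simpa using hd' a b) hΦl) hv1 hv1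
  have b3 := hasDerivAt_bil (G := fun ε : ℝ => scaledMatrix g f e' (y t + ε • W))
    (t := 0) (fun a b => hasDerivAt_comp_curve (F := fun z => scaledMatrix g f e' z a b)
      (X := fun ε : ℝ => y t + ε • W) (t := 0) (by simpa using hd' a b) hL)
    (hasDerivAt_const 0 (velocity y t)) (hasDerivAt_const 0 (velocity y t))
  rw [a1, b1, a2.deriv, b2.deriv] at h
  rw [a3.deriv, b3.deriv]
  simp only [zero_smul, add_zero, z1, z2] at h ⊢
  -- The second derivatives of the change of chart enter as `D²Φ(v, w)` from the curve and `D²Φ(w,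
  -- v)` from the variation; their symmetry makes them cancel.
  rw [hsymm.eq v w, bil_comm (scaledMatrix_isSymm g f _) (fderiv ℝ (fderiv ℝ Φ) (x t) w v),
    ← hvt] at h
  linarith

end BaseCurves

/-- Local existence of geodesics of a connection with smooth coefficients. -/
theorem exists_acceleration_eq_zero {κ : Type*} [Fintype κ] {Γ : (κ → ℝ) → κ → κ → κ → ℝ}
    {U : Set (κ → ℝ)} (hU : IsOpen U)
    (hΓ : ∀ z ∈ U, ∀ c a b, ContDiffAt ℝ ∞ (fun z => Γ z c a b) z) {x₀ : κ → ℝ} (hx₀ : x₀ ∈ U)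
    (ξ : κ → ℝ) :
    ∃ ε > 0, ∃ x : ℝ → κ → ℝ, x 0 = x₀ ∧ velocity x 0 = ξ ∧ ∀ t ∈ Set.Ioo (-ε) ε,
      x t ∈ U ∧ ContDiffAt ℝ 2 x t ∧ acceleration Γ x t = 0 := by
  -- The geodesic equation as a first-order system for position and velocity, solved by
  -- Picard–Lindelöf.
  let F : (κ → ℝ) × (κ → ℝ) → (κ → ℝ) × (κ → ℝ) := fun y =>
    (y.2, fun c => - ∑ a, ∑ b, Γ y.1 c a b * y.2 a * y.2 b)
  have hF : ∀ y : (κ → ℝ) × (κ → ℝ), y.1 ∈ U → ContDiffAt ℝ 1 F y := by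
    intro y hy
    have hsnd : ∀ a, ContDiffAt ℝ 1 (fun y : (κ → ℝ) × (κ → ℝ) => y.2 a) y := fun a =>
      (contDiff_apply ℝ ℝ a).contDiffAt.comp y contDiffAt_snd
    refine contDiffAt_snd.prodMk (contDiffAt_pi.2 fun c => (ContDiffAt.sum fun a _ =>
      ContDiffAt.sum fun b _ => ((ContDiffAt.comp (g := fun z => Γ z c a b) y
        ((hΓ y.1 hy c a b).of_le (by simp)) contDiffAt_fst).mul (hsnd a)).mul (hsnd b)).neg)
  obtain ⟨α, hα0, ε, hε, hα⟩ :=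
    (hF (x₀, ξ) hx₀).exists_forall_mem_closedBall_exists_eq_forall_mem_Ioo_hasDerivAt₀ 0
  simp only [zero_sub, zero_add] at hα
  have hcont : ContinuousAt (fun s => (α s).1) 0 :=
    continuousAt_fst.comp (hα 0 ⟨by linarith, hε⟩).continuousAt
  -- The interval is shrunk so that the position stays in `U`, where the coefficients are smooth.
  obtain ⟨δ, hδ, hball⟩ := Metric.mem_nhds_iff.1
    (hcont.preimage_mem_nhds (hU.mem_nhds (by rw [hα0]; exact hx₀)))
  have hJ : ∀ t ∈ Set.Ioo (-min ε δ) (min ε δ), (α t).1 ∈ U ∧ HasDerivAt α (F (α t)) t := by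
    intro t ht
    have h1 := min_le_left ε δ
    have h2 := min_le_right ε δ
    refine ⟨hball ?_, hα t ⟨by linarith [ht.1], by linarith [ht.2]⟩⟩
    rw [Metric.mem_ball, Real.dist_eq, sub_zero, abs_lt]
    exact ⟨by linarith [ht.1], by linarith [ht.2]⟩
  have hderiv : ∀ t ∈ Set.Ioo (-min ε δ) (min ε δ),
      HasDerivAt (fun s => (α s).1) (α t).2 t := fun t ht =>
    (hasFDerivAt_fst (𝕜 := ℝ) (p := α t)).comp_hasDerivAt t (hJ t ht).2
  have hderiv2 : ∀ t ∈ Set.Ioo (-min ε δ) (min ε δ),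
      HasDerivAt (fun s => (α s).2) (F (α t)).2 t := fun t ht =>
    (hasFDerivAt_snd (𝕜 := ℝ) (p := α t)).comp_hasDerivAt t (hJ t ht).2
  have hvel : ∀ t ∈ Set.Ioo (-min ε δ) (min ε δ), velocity (fun s => (α s).1) t = (α t).2 :=
    fun t ht => funext fun a => (hasDerivAt_pi.1 (hderiv t ht) a).deriv
  have h0 : (0 : ℝ) ∈ Set.Ioo (-min ε δ) (min ε δ) := by
    have := lt_min hε hδ
    exact ⟨by linarith, this⟩
  refine ⟨min ε δ, lt_min hε hδ, fun s => (α s).1, by simp [hα0], by simp [hvel 0 h0, hα0],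
    fun t ht => ⟨(hJ t ht).1, ?_, ?_⟩⟩
  -- The derivative of the velocity equals a continuous function by the equation itself, so the
  -- velocity is `C¹` and the position `C²`.
  · have hv : ContDiffOn ℝ 1 (fun s => (α s).2) (Set.Ioo (-min ε δ) (min ε δ)) := by
      rw [show (1 : WithTop ℕ∞) = 0 + 1 by simp, contDiffOn_succ_iff_deriv_of_isOpen isOpen_Ioo]
      refine ⟨fun s hs => (hderiv2 s hs).differentiableAt.differentiableWithinAt, by simp, ?_⟩
      rw [contDiffOn_zero]
      intro s hs
      refine ContinuousAt.continuousWithinAt ?_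
      have : ContinuousAt (fun s => (F (α s)).2) s := continuousAt_snd.comp
        ((hF (α s) (hJ s hs).1).continuousAt.comp (hJ s hs).2.continuousAt)
      refine this.congr ?_
      filter_upwards [isOpen_Ioo.mem_nhds hs] with r hr
      exact (hderiv2 r hr).deriv.symm
    have hx : ContDiffOn ℝ 2 (fun s => (α s).1) (Set.Ioo (-min ε δ) (min ε δ)) := by
      rw [show (2 : WithTop ℕ∞) = 1 + 1 by norm_num,
        contDiffOn_succ_iff_deriv_of_isOpen isOpen_Ioo]
      exact ⟨fun s hs => (hderiv s hs).differentiableAt.differentiableWithinAt, by simp,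
        hv.congr fun s hs => (hderiv s hs).deriv⟩
    exact hx.contDiffAt (isOpen_Ioo.mem_nhds ht)
  · funext c
    have h1 : (fun r => velocity (fun s => (α s).1) r c) =ᶠ[nhds t] fun r => (α r).2 c := by
      filter_upwards [isOpen_Ioo.mem_nhds ht] with r hr
      rw [hvel r hr]
    rw [acceleration, h1.deriv_eq, (hasDerivAt_pi.1 (hderiv2 t ht) c).deriv, hvel t ht]
    simp [F]

/-! ### Geodesics in the zero section and the three claims. -/

section Main

variable {n : ℕ} {M : Type*} [TopologicalSpace M]
  [ChartedSpace (EuclideanSpace ℝ (Fin n)) M] [IsManifold (𝓡 n) ∞ M]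
  {g : Metric n M} {f : M → ℝ}

omit [IsManifold (𝓡 n) ∞ M] in
theorem bundleCoord_zero {p q : ℕ} (e : OpenPartialHomeomorph M (EuclideanSpace ℝ (Fin n)))
    (y : M) : bundleCoord e (⟨y, 0⟩ : TensorBundle n M p q) = mkIdx (coord e y) 0 := rfl

theorem velocity_mkIdx_zero {p q : ℕ} (x : ℝ → Fin n → ℝ) (t : ℝ) :
    velocity (fun s => (mkIdx (x s) 0 : Idx n p q → ℝ)) t = mkIdx (velocity x t) 0 := by
  funext c
  rcases c with i | ⟨i, j⟩
  · rfl
  · exact deriv_const t 0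

/-- At `t = 0` the connection term vanishes, so curves in the zero section have horizontal velocity.
-/
theorem verticalPart_mkIdx_zero {p q : ℕ}
    (e : OpenPartialHomeomorph M (EuclideanSpace ℝ (Fin n))) (x v : Fin n → ℝ) :
    verticalPart g e (mkIdx x 0 : Idx n p q → ℝ) (mkIdx v 0) = 0 := by
  rw [verticalPart_eq, fibrePart_mkIdx, fibrePart_mkIdx, ← zero_smul ℝ (0 : Components n p q),
    act_smul, zero_smul, zero_smul, add_zero]

/-- Every vector of unit length for `f g` is the velocity of the projection of a geodesic
parametrized by arc length, which lies in the zero section. -/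
theorem exists_isBundleGeodesic_isUnitSpeed (p q : ℕ) (hf : ContMDiff (𝓡 n) 𝓘(ℝ, ℝ) ∞ f)
    (hpos : ∀ x, 0 < f x) {e : OpenPartialHomeomorph M (EuclideanSpace ℝ (Fin n))}
    (he : e ∈ IsManifold.maximalAtlas (𝓡 n) ∞ M) {x₀ : Fin n → ℝ} (hx₀ : x₀ ∈ coordDomain e)
    {ξ : Fin n → ℝ} (hξ : bil (scaledMatrix g f e x₀) ξ ξ = 1) :
    ∃ (J : Set ℝ) (c : ℝ → TensorBundle n M p q), IsBundleGeodesic g f J c ∧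
      IsUnitSpeed g f J c ∧ 0 ∈ J ∧ proj (c 0) ∈ e.source ∧ coord e (proj (c 0)) = x₀ ∧
      velocity (fun s => coord e (proj (c s))) 0 = ξ := by
  obtain ⟨ε, hε, x, hx0, hv0, hx⟩ := exists_acceleration_eq_zero
    (Γ := christoffel (scaledMatrix g f e)) (isOpen_coordDomain e)
    (fun z hz => contDiffAt_christoffel (contDiffAt_scaledMatrix g f he hf hz)
      (isUnit_det_scaledMatrix g f he hpos hz)) hx₀ ξ
  have h0 : (0 : ℝ) ∈ Set.Ioo (-ε) ε := ⟨by linarith, hε⟩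
  -- The energy for `f g` is constant on the interval and equals 1 at time 0.
  have hspeed : ∀ t ∈ Set.Ioo (-ε) ε,
      bil (scaledMatrix g f e (x t)) (velocity x t) (velocity x t) = 1 := by
    intro t ht
    have hE : ∀ s ∈ Set.Ioo (-ε) ε, HasDerivAt
        (fun s => bil (scaledMatrix g f e (x s)) (velocity x s) (velocity x s)) 0 s :=
      fun s hs => hasDerivAt_energy he hf hpos (hx s hs).2.1 (hx s hs).1 (hx s hs).2.2
    have := isOpen_Ioo.is_const_of_deriv_eq_zero isPreconnected_Ioo
      (fun s hs => (hE s hs).differentiableAt.differentiableWithinAt)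
      (fun s hs => (hE s hs).deriv) ht h0
    rw [this, hx0, hv0, hξ]
  refine ⟨Set.Ioo (-ε) ε, fun s => ⟨point e (x s), 0⟩, ⟨isOpen_Ioo, Set.ordConnected_Ioo, ?_, ?_⟩,
    ?_, h0, ?_, ?_, ?_⟩
  · intro t ht
    have h1 : ContinuousAt e.symm (WithLp.toLp 2 (x t)) := e.continuousAt_symm (hx t ht).1
    exact (ContinuousAt.comp (f := fun s => (WithLp.toLp 2 (x s) : EuclideanSpace ℝ (Fin n))) h1
      ((PiLp.continuous_toLp 2 _).continuousAt.comp
        (hx t ht).2.1.continuousAt)).continuousWithinAt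
  -- The solution was built in `e`, but the equation is required in every chart: the base part
  -- follows by change of chart, and the vertical part vanishes because the tensor field is zero.
  · intro e' he' t ht ht'
    have hy2 : ContDiffAt ℝ 2 (fun s => transition e e' (x s)) t :=
      ((contDiffAt_transition he he' (hx t ht).1 ht').of_le two_le_infty).comp t (hx t ht).2.1
    have hX : ContDiffAt ℝ 2
        (fun s => bundleCoord e' (⟨point e (x s), 0⟩ : TensorBundle n M p q)) t := by
      refine contDiffAt_pi.2 fun c => ?_
      rcases c with i | ⟨i, j⟩
      · exact contDiffAt_pi.1 hy2 i
      · exact contDiffAt_const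
    refine ⟨hX, ?_⟩
    have hdom : basePart (bundleCoord e' (⟨point e (x t), 0⟩ : TensorBundle n M p q)) ∈
        coordDomain e' := coord_mem_coordDomain ht'
    rw [geodesicEquation_iff]
    refine eq_zero_of_verticalPart (g := g) (e := e')
      (z := bundleCoord e' (⟨point e (x t), 0⟩ : TensorBundle n M p q)) ?_ ?_
    · rw [basePart_acceleration he' hf hpos hX hdom]
      exact acceleration_transition he hf hpos (hx t ht).2.1 (hx t ht).1 he' ht' (hx t ht).2.2
    · rw [verticalPart_acceleration he' hf hpos hX hdom]
      simp only [secondCovDeriv, bundleCoord_zero, velocity_mkIdx_zero, verticalPart_mkIdx_zero]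
      rw [← zero_smul ℝ (0 : Components n p q), act_smul, zero_smul, zero_smul, add_zero]
      funext i j
      exact deriv_const t 0
  · intro e' he' t ht ht'
    change sasaki g f e' _ (velocity _ t) (velocity _ t) = 1
    simp only [bundleCoord_zero, velocity_mkIdx_zero, sasaki_eq, verticalPart_mkIdx_zero,
      tensorInner_zero_right, add_zero, basePart_mkIdx]
    have hv := velocity_transition he (hx t ht).2.1 (hx t ht).1 he' ht'
    have h1 := bil_scaledMatrix_transition (g := g) (f := f) he he' (hx t ht).1 ht'
      (velocity x t) (velocity x t)
    rw [hspeed t ht, ← hv] at h1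
    exact h1.symm
  · exact point_mem_source (hx 0 h0).1
  · exact (coord_point (hx 0 h0).1).trans hx0
  · rw [← hv0]
    funext a
    refine Filter.EventuallyEq.deriv_eq ?_
    filter_upwards [isOpen_Ioo.mem_nhds h0] with s hs
    exact congrFun (coord_point (hx s hs).1) a

/-- A smooth function on a connected manifold whose differential vanishes in all charts is
constant. -/
theorem exists_eq_const_of_fderiv [ConnectedSpace M] (hf : ContMDiff (𝓡 n) 𝓘(ℝ, ℝ) ∞ f)
    (h : ∀ e ∈ IsManifold.maximalAtlas (𝓡 n) ∞ M, ∀ x ∈ coordDomain e,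
      fderiv ℝ (fun z => f (point e z)) x = 0) : ∃ C, ∀ x, f x = C := by
  have hloc : IsLocallyConstant f := by
    refine (IsLocallyConstant.iff_eventually_eq f).2 fun y => ?_
    set e := chartAt (EuclideanSpace ℝ (Fin n)) y
    have he : e ∈ IsManifold.maximalAtlas (𝓡 n) ∞ M := IsManifold.chart_mem_maximalAtlas y
    have hy : y ∈ e.source := mem_chart_source _ y
    obtain ⟨δ, hδ, hball⟩ := Metric.isOpen_iff.1 (isOpen_coordDomain e) (coord e y)
      (coord_mem_coordDomain hy)
    have hc : ContinuousAt (coord e) y :=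
      (PiLp.continuous_ofLp 2 _).continuousAt.comp (e.continuousAt hy)
    filter_upwards [e.open_source.mem_nhds hy, hc.preimage_mem_nhds (Metric.ball_mem_nhds _ hδ)]
      with w hw hw'
    -- A coordinate ball is convex, hence connected, so a vanishing differential forces constancy on
    -- it.
    have := (Metric.isOpen_ball (x := coord e y) (ε := δ)).is_const_of_fderiv_eq_zero (𝕜 := ℝ)
      (f := fun z => f (point e z)) (convex_ball _ _).isPreconnected
      (fun z hz => ((contDiffAt_comp_point hf he (hball hz)).differentiableAt
        (by simp)).differentiableWithinAt) (fun z hz => h e he z (hball hz)) hw'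
      (Metric.mem_ball_self hδ)
    simpa only [point_coord hw, point_coord hy] using this
  obtain ⟨y⟩ := (inferInstance : Nonempty M)
  exact ⟨f y, fun x => hloc.apply_eq_of_preconnectedSpace x y⟩

/-- If `df(η) ≠ 0` at some point, the unit-speed geodesic in the zero section with initial direction
`η` projects to a curve that is a geodesic of both `f g` and `g`, which forces `df(η) = 0`. -/
theorem exists_eq_const_of_isGeodesic [ConnectedSpace M] (p q : ℕ)
    (hf : ContMDiff (𝓡 n) 𝓘(ℝ, ℝ) ∞ f) (hpos : ∀ x, 0 < f x)
    (h : ∀ (J : Set ℝ) (c : ℝ → TensorBundle n M p q), IsBundleGeodesic g f J c →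
      IsUnitSpeed g f J c → IsGeodesic g J (fun t => proj (c t))) : ∃ C, ∀ x, f x = C := by
  refine exists_eq_const_of_fderiv hf fun e he x₀ hx₀ => ?_
  by_contra hne
  obtain ⟨η, hη⟩ := DFunLike.ne_iff.1 hne
  rw [zero_apply] at hη
  have hη0 : η ≠ 0 := fun h0 => hη (by rw [h0, map_zero])
  have hlen : 0 < bil (scaledMatrix g f e x₀) η η := by
    rw [bil_scaledMatrix]
    exact mul_pos (hpos _) (bil_metricMatrix_pos g he hx₀ hη0)
  -- Rescales `η` to unit length for `f g`; this keeps `df(η)` non-zero.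
  set r := (√(bil (scaledMatrix g f e x₀) η η))⁻¹ with hr
  have hr0 : r ≠ 0 := inv_ne_zero (Real.sqrt_ne_zero'.2 hlen)
  have hunit : bil (scaledMatrix g f e x₀) (r • η) (r • η) = 1 := by
    rw [bil_smul_left, bil_comm (scaledMatrix_isSymm g f _), bil_smul_left, ← mul_assoc, hr,
      ← mul_inv, Real.mul_self_sqrt hlen.le, inv_mul_cancel₀ hlen.ne']
  obtain ⟨J, c, hc, hs, h0, hsrc, hx, hv⟩ :=
    exists_isBundleGeodesic_isUnitSpeed p q hf hpos he hx₀ hunit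
  obtain ⟨hX, hgeo⟩ := hc.2.2.2 e he 0 h0 hsrc
  obtain ⟨hx2, hgeo'⟩ := (h J c hc hs).2.2.2 e he 0 h0 hsrc
  have hdom : basePart (bundleCoord e (c 0)) ∈ coordDomain e := coord_mem_coordDomain hsrc
  rw [geodesicEquation_iff] at hgeo hgeo'
  have hacc := basePart_acceleration (g := g) he hf hpos hX hdom
  rw [hgeo] at hacc
  have := fderiv_eq_zero_of_acceleration he hf hpos hx2 hdom hacc.symm hgeo'
  rw [hx, hv] at this
  rcases mul_eq_zero.1 this with h1 | h1
  · rw [map_smul, smul_eq_mul] at h1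
    exact (mul_ne_zero hr0 hη) h1
  · exact (bil_metricMatrix_pos g he hx₀ (smul_ne_zero hr0 hη0)).ne' h1

theorem hasVanishingSecondCovDeriv_of_isBundleGeodesic {p q : ℕ}
    (hf : ContMDiff (𝓡 n) 𝓘(ℝ, ℝ) ∞ f) (hpos : ∀ x, 0 < f x) {J : Set ℝ}
    {c : ℝ → TensorBundle n M p q} (hc : IsBundleGeodesic g f J c) :
    HasVanishingSecondCovDeriv g J c := by
  intro e he t ht hsrc
  obtain ⟨hX, hgeo⟩ := hc.2.2.2 e he t ht hsrc
  rw [geodesicEquation_iff] at hgeo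
  have h := verticalPart_acceleration (g := g) he hf hpos hX (coord_mem_coordDomain hsrc)
  rw [hgeo, ← zero_smul ℝ (0 : Idx n p q → ℝ), verticalPart_smul, zero_smul] at h
  exact h.symm

theorem isGeodesic_of_isBundleGeodesic {p q : ℕ}
    (hf : ContMDiff (𝓡 n) 𝓘(ℝ, ℝ) ∞ f) (hpos : ∀ x, 0 < f x) {C : ℝ} (hC : ∀ x, f x = C)
    {J : Set ℝ} {c : ℝ → TensorBundle n M p q} (hc : IsBundleGeodesic g f J c) :
    IsGeodesic g J (fun t => proj (c t)) := by
  refine ⟨hc.1, hc.2.1, hc.2.2.1, fun e he t ht hsrc => ?_⟩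
  obtain ⟨hX, hgeo⟩ := hc.2.2.2 e he t ht hsrc
  have hdom : basePart (bundleCoord e (c t)) ∈ coordDomain e := coord_mem_coordDomain hsrc
  have hx : ContDiffAt ℝ 2 (fun s => basePart (bundleCoord e (c s))) t :=
    contDiff_basePart.contDiffAt.comp t hX
  refine ⟨hx, ?_⟩
  rw [geodesicEquation_iff] at hgeo ⊢
  have hacc := basePart_acceleration (g := g) he hf hpos hX hdom
  rw [hgeo] at hacc
  exact acceleration_eq_zero_of_const he hf hpos hx hdom hC hacc.symm

end Main

end RescaledSasaki

end

theorem mainTheorem12 {n : ℕ} {M : Type*} [TopologicalSpace M]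
    [ChartedSpace (EuclideanSpace ℝ (Fin n)) M] [IsManifold (𝓡 n) ∞ M] [ConnectedSpace M]
    (g : RescaledSasaki.Metric n M) (f : M → ℝ) (hf : ContMDiff (𝓡 n) 𝓘(ℝ, ℝ) ∞ f)
    (hpos : ∀ x, 0 < f x) (p q : ℕ) :
    (∀ (J : Set ℝ) (c : ℝ → RescaledSasaki.TensorBundle n M p q),
      RescaledSasaki.IsBundleGeodesic g f J c →
        RescaledSasaki.HasVanishingSecondCovDeriv g J c) ∧
    ((∀ (J : Set ℝ) (c : ℝ → RescaledSasaki.TensorBundle n M p q),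
      RescaledSasaki.IsBundleGeodesic g f J c →
        RescaledSasaki.IsGeodesic g J (fun t => RescaledSasaki.proj (c t))) ↔
      ∃ C : ℝ, ∀ x, f x = C) ∧
    ((∀ (J : Set ℝ) (c : ℝ → RescaledSasaki.TensorBundle n M p q),
      RescaledSasaki.IsBundleGeodesic g f J c → RescaledSasaki.IsUnitSpeed g f J c →
        RescaledSasaki.IsGeodesic g J (fun t => RescaledSasaki.proj (c t))) ↔
      ∃ C : ℝ, ∀ x, f x = C) := by
  -- For the implication towards constant `f`, claim 2 reduces to claim 3, since its hypothesis
  -- covers more geodesics.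
  refine ⟨fun J c hc => RescaledSasaki.hasVanishingSecondCovDeriv_of_isBundleGeodesic hf hpos hc,
    ⟨fun h => RescaledSasaki.exists_eq_const_of_isGeodesic p q hf hpos fun J c hc _ =>
      h J c hc, ?_⟩,
    ⟨fun h => RescaledSasaki.exists_eq_const_of_isGeodesic p q hf hpos h, ?_⟩⟩
  · rintro ⟨C, hC⟩ J c hc
    exact RescaledSasaki.isGeodesic_of_isBundleGeodesic hf hpos hC hc
  · rintro ⟨C, hC⟩ J c hc _
    exact RescaledSasaki.isGeodesic_of_isBundleGeodesic hf hpos hC hc
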